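/- **Conventions.** Let $R$ be a commutative ring with $1$ and $Q$ a quiver with vertex set $Q_0$. Paths are composed from left to right: $pq\neq 0$ in the path algebra $RQ$ only if the terminus of $p$ is the origin of $q$. Write $e_i$ for the vertex $i$ regarded as an element of $RQ$, and $i\preceq j$ if there is a path with origin $i$ and terminus $j$. The quiver is *locally finite* if each vertex is the origin of finitely many arrows and the terminus of finitely many arrows; *downward directed* if any two vertices $i,j$ have a common predecessor $k\preceq i$, $k\preceq j$; *narrow* if $\{k\in Q_0 : k\preceq i,\ k\not\preceq j\}$ is finite whenever $j\preceq i$. Let $\rho\subseteq\bigcup_{i,j}e_iRQe_j$ be a set of relations, each of which is an $R$-linear combination of paths of length $\ge 2$, such that $\rho\cap RQe_i$ is finite for every $i\in Q_0$ (so that $A$ is *locally finitely presented* by $(Q,\rho)$). Put $A=RQ/\langle\rho\rangle$, write again $e_i$ for the image of $e_i$ in $A$, and let $J$ be the image in $A$ of the ideal of $RQ$ spanned by the paths of length $\ge 1$, so that $A=B\oplus J$ with $B=\bigoplus_{i}Re_i$; $B=A/J$ is a left $A$-module through $A\to A/J$. Let $A\text{-Mod}$ be the category of left $A$-modules $M$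 with $AM=M$. A module $M$ in it is *torsion* if each of its elements is annihilated by some power $J^n$; $\mathcal T$ is the full subcategory of torsion modules, $t(M)$ is the submodule of elements of $M$ annihilated by some power of $J$, and $A\text{-Mod}/\mathcal T$ is the localization of $A\text{-Mod}$ at the morphisms whose kernel and cokernel are torsion. In a locally finitely presented Grothendieck category, an object $F$ is *flat* if every epimorphism $M\to F$ is pure, i.e. every morphism from a finitely presented object to $F$ lifts along $M\to F$. **Theorem.** Let $A$ be locally finitely presented by $(Q,\rho)$ as above, where $Q$ is connected, locally finite and has no oriented cycles. 1. If every element of $\rho$ is homogeneous for the grading of $RQ$ by path length, $t(A)=0$, and for each $i\in Q_0$ there are only finitely many $j\in Q_0$ with $i\preceq j$, then $\mathcal T$ is a locally finitely presented Grothendieck category with no nonzero flat objects. 2. If $Q$ is downward directed and narrow and $\operatorname{Ext}^1_A\bigl(Be_i,\,Ae_j/t(A)e_j\bigr)=0$ for all $i,j\in Q_0$ (with $\operatorname{Ext}$ taken in $A\text{-Mod}$), then $A\text{-Mod}/\mathcal T$ is a locally finitely presented Grothendieck category with no nonzero flat objects. -/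

import Mathlib

open CategoryTheory CategoryTheory.Limits

universe w v u

namespace QuiverRel

/-! ### Path algebras -/

section PathAlgebra

/-- A path of the quiver `V`, together with its origin `p.1` and its terminus `p.2.1`. -/
abbrev TotalPath (V : Type u) [Quiver.{u} V] : Type u :=
  Σ i j : V, Quiver.Path i j

/-- The length of a path. -/
def len {V : Type u} [Quiver.{u} V] (p : TotalPath V) : ℕ := p.2.2.length

/-- The free `R`-module `RQ` on the set of all paths of the quiver `V`. -/
def PathAlgebra (R : Type u) [CommRing R] (V : Type u) [Quiver.{u} V] : Type u :=
  TotalPath V →₀ R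

variable (R : Type u) [CommRing R] {V : Type u} [Quiver.{u} V]

noncomputable instance : AddCommGroup (PathAlgebra R V) :=
  inferInstanceAs (AddCommGroup (TotalPath V →₀ R))

noncomputable instance : Module R (PathAlgebra R V) :=
  inferInstanceAs (Module R (TotalPath V →₀ R))

/-- The coefficients of an element of `RQ`. -/
noncomputable def coeffs : PathAlgebra R V ≃ₗ[R] (TotalPath V →₀ R) :=
  LinearEquiv.refl R (TotalPath V →₀ R)

variable {R} in
/-- The (finite) set of paths that occur in an element of `RQ`. -/
noncomputable def paths (x : PathAlgebra R V) : Finset (TotalPath V) := (coeffs R x).support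

/-- A path, as an element of `RQ`. -/
noncomputable def ofPath (p : TotalPath V) : PathAlgebra R V :=
  (coeffs R).symm (Finsupp.single p 1)

/-- `RQ_{≥ n}`: the `R`-linear combinations of paths of length `≥ n`. -/
noncomputable def pathsGE (n : ℕ) : Submodule R (PathAlgebra R V) :=
  (Finsupp.supported R R {p : TotalPath V | n ≤ len p}).comap (coeffs R).toLinearMap

/-- The vertex `i`, that is the path of length `0` at `i`, as an element of `RQ`. -/
noncomputable def vertex (i : V) : PathAlgebra R V :=
  ofPath R ⟨i, i, Quiver.Path.nil⟩

open Classical in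
/-- The product of two paths: the concatenation `p q` if the terminus of `p` is the origin of `q`,
and `0` otherwise. -/
noncomputable def mulPath (p q : TotalPath V) : PathAlgebra R V :=
  if h : p.2.1 = q.1 then ofPath R ⟨p.1, q.2.1, (p.2.2.cast rfl h).comp q.2.2⟩ else 0

/-- The multiplication of `RQ`, the bilinear extension of the product of paths. -/
noncomputable def mulLin : PathAlgebra R V →ₗ[R] PathAlgebra R V →ₗ[R] PathAlgebra R V :=
  (Finsupp.lift (PathAlgebra R V →ₗ[R] PathAlgebra R V) R (TotalPath V) fun p =>
    (Finsupp.lift (PathAlgebra R V) R (TotalPath V) fun q => mulPath R p q).comp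
      (coeffs R).toLinearMap).comp (coeffs R).toLinearMap

noncomputable instance : Mul (PathAlgebra R V) := ⟨fun x y => mulLin R x y⟩

lemma mul_def (x y : PathAlgebra R V) : x * y = mulLin R x y := rfl

lemma ofPath_mul_ofPath (p q : TotalPath V) :
    ofPath R p * ofPath R q = mulPath R p q := by
  simp [mul_def, mulLin, ofPath]

lemma ofPath_mul_ofPath_of_eq {i j k : V} (p : Quiver.Path i j) (q : Quiver.Path j k) :
    ofPath R ⟨i, j, p⟩ * ofPath R ⟨j, k, q⟩ = ofPath R ⟨i, k, p.comp q⟩ := by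
  rw [ofPath_mul_ofPath, mulPath, dif_pos rfl]; rfl

lemma ofPath_mul_ofPath_of_ne {p q : TotalPath V} (h : p.2.1 ≠ q.1) :
    ofPath R p * ofPath R q = 0 := by
  rw [ofPath_mul_ofPath, mulPath, dif_neg h]

variable {R} in
lemma PathAlgebra.induction {P : PathAlgebra R V → Prop} (x : PathAlgebra R V)
    (h0 : P 0) (hadd : ∀ x y, P x → P y → P (x + y))
    (hp : ∀ (a : R) (p : TotalPath V), P (a • ofPath R p)) : P x := by
  obtain ⟨x, rfl⟩ := (coeffs R).symm.surjective x
  induction x using Finsupp.induction_linear with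
  | zero => simpa using h0
  | add x y hx hy => simpa using hadd _ _ hx hy
  | single p a => simpa [ofPath, ← map_smul] using hp a p

protected lemma smul_mul (a : R) (x y : PathAlgebra R V) : a • x * y = a • (x * y) := by
  simp [mul_def]

protected lemma mul_smul' (a : R) (x y : PathAlgebra R V) : x * a • y = a • (x * y) := by
  simp [mul_def]

noncomputable instance : NonUnitalNonAssocRing (PathAlgebra R V) where
  left_distrib x y z := by simp only [mul_def, map_add]
  right_distrib x y z := by simp only [mul_def, map_add, LinearMap.add_apply]
  zero_mul x := by rw [mul_def, map_zero, LinearMap.zero_apply]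
  mul_zero x := by rw [mul_def, map_zero]

lemma ofPath_mul_assoc (p q r : TotalPath V) :
    ofPath R p * ofPath R q * ofPath R r = ofPath R p * (ofPath R q * ofPath R r) := by
  obtain ⟨i, j, p⟩ := p
  obtain ⟨j', k, q⟩ := q
  obtain ⟨k', l, r⟩ := r
  by_cases h : j = j'
  · subst h
    rw [ofPath_mul_ofPath_of_eq]
    by_cases h' : k = k'
    · subst h'
      simp only [ofPath_mul_ofPath_of_eq, Quiver.Path.comp_assoc]
    · rw [ofPath_mul_ofPath_of_ne R (p := ⟨i, k, _⟩) h', ofPath_mul_ofPath_of_ne R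
        (p := ⟨j, k, _⟩) h', mul_zero]
  · rw [ofPath_mul_ofPath_of_ne R (p := ⟨i, j, p⟩) (q := ⟨j', k, q⟩) h, zero_mul]
    by_cases h' : k = k'
    · subst h'
      rw [ofPath_mul_ofPath_of_eq, ofPath_mul_ofPath_of_ne R h]
    · rw [ofPath_mul_ofPath_of_ne R (p := ⟨j', k, _⟩) h', mul_zero]

noncomputable instance : NonUnitalRing (PathAlgebra R V) where
  mul_assoc x y z := by
    refine PathAlgebra.induction (P := fun x => x * y * z = x * (y * z)) x
      (by simp only [zero_mul]) (fun x x' h h' => by simp only [add_mul, h, h']) (fun a p => ?_)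
    refine PathAlgebra.induction (P := fun y => a • ofPath R p * y * z = a • ofPath R p * (y * z)) y
      (by simp only [zero_mul, mul_zero])
      (fun y y' h h' => by simp only [add_mul, mul_add, h, h']) (fun b q => ?_)
    refine PathAlgebra.induction
      (P := fun z => a • ofPath R p * b • ofPath R q * z = a • ofPath R p * (b • ofPath R q * z)) z
      (by simp only [mul_zero]) (fun z z' h h' => by simp only [mul_add, h, h']) (fun c r => ?_)
    simp only [QuiverRel.smul_mul, QuiverRel.mul_smul', ofPath_mul_assoc]

instance : IsScalarTower R (PathAlgebra R V) (PathAlgebra R V) :=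
  ⟨fun a x y => QuiverRel.smul_mul R a x y⟩

instance : SMulCommClass R (PathAlgebra R V) (PathAlgebra R V) :=
  ⟨fun a x y => (QuiverRel.mul_smul' R a x y).symm⟩

variable {R} in
lemma pathsGE_induction {n : ℕ} {P : PathAlgebra R V → Prop} {x : PathAlgebra R V}
    (hx : x ∈ pathsGE R n) (h0 : P 0) (hadd : ∀ x y, P x → P y → P (x + y))
    (hp : ∀ (a : R) (p : TotalPath V), n ≤ len p → P (a • ofPath R p)) : P x := by
  obtain ⟨x, rfl⟩ := (coeffs R).symm.surjective x
  have hx' : x ∈ Finsupp.supported R R {p : TotalPath V | n ≤ len p} := by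
    simpa [pathsGE] using hx
  rw [Finsupp.mem_supported] at hx'
  rw [← Finsupp.sum_single x, Finsupp.sum, map_sum]
  refine Finset.sum_induction _ P hadd h0 fun p hpx => ?_
  have := hp (x p) p (hx' hpx)
  simpa [ofPath, ← map_smul] using this

lemma ofPath_mem_pathsGE {n : ℕ} {p : TotalPath V} (h : n ≤ len p) : ofPath R p ∈ pathsGE R n := by
  simpa [pathsGE, ofPath] using Finsupp.single_mem_supported R (1 : R)
    (s := {p : TotalPath V | n ≤ len p}) h

lemma mul_mem_pathsGE {n : ℕ} {x : PathAlgebra R V} (hx : x ∈ pathsGE R n) (y : PathAlgebra R V) :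
    x * y ∈ pathsGE R n := by
  refine pathsGE_induction (P := fun x => x * y ∈ pathsGE R n) hx
    (by rw [zero_mul]; exact Submodule.zero_mem _)
    (fun x x' h h' => by rw [add_mul]; exact Submodule.add_mem _ h h') (fun a p hp => ?_)
  refine PathAlgebra.induction (P := fun y => a • ofPath R p * y ∈ pathsGE R n) y
    (by rw [mul_zero]; exact Submodule.zero_mem _)
    (fun x x' h h' => by rw [mul_add]; exact Submodule.add_mem _ h h') (fun b q => ?_)
  rw [QuiverRel.mul_smul', QuiverRel.smul_mul]
  refine Submodule.smul_mem _ _ (Submodule.smul_mem _ _ ?_)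
  obtain ⟨i, j, p⟩ := p
  obtain ⟨j', k, q⟩ := q
  by_cases h : j = j'
  · subst h
    rw [ofPath_mul_ofPath_of_eq]
    refine ofPath_mem_pathsGE R (le_trans hp ?_)
    simp [len, Quiver.Path.length_comp]
  · rw [ofPath_mul_ofPath_of_ne R h]
    exact Submodule.zero_mem _

variable {R} in
/-- Path algebras have local units: sums of vertices. -/
lemma exists_local_unit (x : PathAlgebra R V) :
    ∃ s : Finset V, ∀ t : Finset V, s ⊆ t → (∑ i ∈ t, vertex R i) * x = x := by
  classical
  refine PathAlgebra.induction
    (P := fun x => ∃ s : Finset V, ∀ t : Finset V, s ⊆ t → (∑ i ∈ t, vertex R i) * x = x)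
    x ⟨∅, by simp⟩ ?_ ?_
  · rintro x y ⟨s, hs⟩ ⟨s', hs'⟩
    refine ⟨s ∪ s', fun t ht => ?_⟩
    rw [mul_add, hs t (Finset.union_subset_left ht), hs' t (Finset.union_subset_right ht)]
  · rintro a ⟨i, j, p⟩
    refine ⟨{i}, fun t ht => ?_⟩
    rw [QuiverRel.mul_smul', Finset.sum_mul, Finset.sum_eq_single i]
    · rw [vertex, ofPath_mul_ofPath_of_eq, Quiver.Path.nil_comp]
    · intro k _ hk
      exact ofPath_mul_ofPath_of_ne R (p := ⟨k, k, _⟩) (q := ⟨i, j, p⟩) hk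
    · intro hi
      exact absurd (ht (Finset.mem_singleton_self i)) hi

end PathAlgebra

/-! ### Quivers with relations -/

section Relations

variable (V : Type u) [Quiver.{u} V]

/-- The preorder on the vertices: `i ⪯ j` if there is a path with origin `i` and terminus `j`. -/
def Prec {V : Type u} [Quiver.{u} V] (i j : V) : Prop := Nonempty (Quiver.Path i j)

/-- Any two vertices are joined by a walk. -/
def IsConnectedQuiver : Prop :=
  ∀ i j : Quiver.Symmetrify V, Nonempty (Quiver.Path i j)

/-- Each vertex is the origin of finitely many arrows and the terminus of finitely many arrows. -/
def IsLocallyFiniteQuiver : Prop :=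
  ∀ i : V, Finite (Quiver.Star i) ∧ Finite (Quiver.Costar i)

/-- There are no oriented cycles. -/
def HasNoOrientedCycles : Prop :=
  ∀ (i : V) (p : Quiver.Path i i), p.length = 0

/-- Any two vertices have a common predecessor. -/
def IsDownwardDirected : Prop :=
  ∀ i j : V, ∃ k : V, Prec k i ∧ Prec k j

/-- For `j ⪯ i`, all but finitely many predecessors of `i` are predecessors of `j`. -/
def IsNarrow : Prop :=
  ∀ i j : V, Prec j i → {k : V | Prec k i ∧ ¬ Prec k j}.Finite

variable {V} {R : Type u} [CommRing R]

/-- Every `r ∈ ρ` lies in some `e_i RQ e_j` and is a combination of paths of length `≥ 2`. -/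
def IsAdmissible (ρ : Set (PathAlgebra R V)) : Prop :=
  ∀ r ∈ ρ, (∃ i j : V, vertex R i * r * vertex R j = r) ∧ r ∈ pathsGE R 2

/-- For every vertex `i` the set `ρ e_i = ρ ∩ RQ e_i` is finite. -/
def IsLocallyFiniteRel (ρ : Set (PathAlgebra R V)) : Prop :=
  ∀ i : V, {r ∈ ρ | r * vertex R i = r}.Finite

/-- All relations are homogeneous for the length grading. -/
def IsHomogeneousRel (ρ : Set (PathAlgebra R V)) : Prop :=
  ∀ r ∈ ρ, ∃ d : ℕ, ∀ p ∈ paths r, len p = d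

end Relations

/-! ### The algebra `A = RQ / ⟨ρ⟩` -/

section Algebra

variable {V : Type u} [Quiver.{u} V] {R : Type u} [CommRing R] (ρ : Set (PathAlgebra R V))

/-- `A = RQ / ⟨ρ⟩`, where `⟨ρ⟩` is the two-sided ideal generated by `ρ`. -/
def Alg : Type u := (TwoSidedIdeal.span ρ).ringCon.Quotient

noncomputable instance : NonUnitalRing (Alg ρ) :=
  inferInstanceAs (NonUnitalRing (TwoSidedIdeal.span ρ).ringCon.Quotient)

/-- The projection `RQ → A`. -/
noncomputable def proj (x : PathAlgebra R V) : Alg ρ :=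
  ((x : (TwoSidedIdeal.span ρ).ringCon.Quotient))

lemma proj_surjective : Function.Surjective (proj ρ) := Quotient.mk''_surjective

lemma proj_eq_iff (x y : PathAlgebra R V) :
    proj ρ x = proj ρ y ↔ x - y ∈ TwoSidedIdeal.span ρ := by
  rw [← TwoSidedIdeal.rel_iff]
  exact RingCon.eq _

lemma proj_mul (x y : PathAlgebra R V) : proj ρ (x * y) = proj ρ x * proj ρ y := rfl
lemma proj_add (x y : PathAlgebra R V) : proj ρ (x + y) = proj ρ x + proj ρ y := rfl
lemma proj_zero : proj ρ (0 : PathAlgebra R V) = 0 := rfl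

lemma smul_mem_span (a : R) {x : PathAlgebra R V} (hx : x ∈ TwoSidedIdeal.span ρ) :
    a • x ∈ TwoSidedIdeal.span ρ := by
  obtain ⟨s, hs⟩ := exists_local_unit x
  rw [← hs s (Finset.Subset.refl s), ← smul_mul_assoc]
  exact TwoSidedIdeal.mul_mem_left _ _ _ hx

noncomputable instance : SMul R (Alg ρ) :=
  ⟨fun a => Quotient.map' (fun x => a • x) fun x y h => by
    have h' : x - y ∈ TwoSidedIdeal.span ρ := (TwoSidedIdeal.rel_iff _ _ _).1 h
    refine (TwoSidedIdeal.rel_iff _ _ _).2 ?_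
    rw [← smul_sub]
    exact smul_mem_span ρ a h'⟩

lemma proj_smul (a : R) (x : PathAlgebra R V) : proj ρ (a • x) = a • proj ρ x := rfl

noncomputable instance : Module R (Alg ρ) :=
  Function.Surjective.module R
    ({ toFun := proj ρ, map_zero' := rfl, map_add' := fun _ _ => rfl } :
      PathAlgebra R V →+ Alg ρ) (proj_surjective ρ) (proj_smul ρ)

instance : IsScalarTower R (Alg ρ) (Alg ρ) := ⟨fun a x y => by
  obtain ⟨x, rfl⟩ := proj_surjective ρ x
  obtain ⟨y, rfl⟩ := proj_surjective ρ y
  simp only [smul_eq_mul, ← proj_smul, ← proj_mul, smul_mul_assoc]⟩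

instance : SMulCommClass R (Alg ρ) (Alg ρ) := ⟨fun a x y => by
  obtain ⟨x, rfl⟩ := proj_surjective ρ x
  obtain ⟨y, rfl⟩ := proj_surjective ρ y
  simp only [smul_eq_mul, ← proj_smul, ← proj_mul, mul_smul_comm]⟩

/-- The algebra `A` has no unit in general. A left module over the unital ring `A¹ = R ⊕ A` is the
same thing as an `R`-module with a compatible action of the `R`-algebra `A`. -/
abbrev Alg1 : Type u := Unitization R (Alg ρ)

/-- The inclusion of `A` in `A¹`. -/
noncomputable def inA (a : Alg ρ) : Alg1 ρ := Unitization.inr a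

/-- The image of an element of `RQ` in `A ⊆ A¹`. -/
noncomputable def img (x : PathAlgebra R V) : Alg1 ρ := inA ρ (proj ρ x)

/-- The idempotent `e_i` of `A`, as an element of `A¹`. -/
noncomputable def idem (i : V) : Alg1 ρ := img ρ (vertex R i)

/-- `A`, as a left ideal of `A¹`. -/
noncomputable def idealA : Ideal (Alg1 ρ) := RingHom.ker (Unitization.fstHom R (Alg ρ))

/-- `J = RQ_{≥ 1} / ⟨ρ⟩`, as a left ideal of `A¹`. The generating set is already closed under the
operations, so that `span` does not enlarge it. -/
noncomputable def idealJ : Ideal (Alg1 ρ) := Ideal.span (img ρ '' (pathsGE R 1 : Submodule R (PathAlgebra R V)))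

lemma inA_mul (a b : Alg ρ) : inA ρ (a * b) = inA ρ a * inA ρ b := Unitization.inr_mul _ _ _

lemma inA_add (a b : Alg ρ) : inA ρ (a + b) = inA ρ a + inA ρ b := Unitization.inr_add _ _ _

lemma mem_idealA {x : Alg1 ρ} : x ∈ idealA ρ ↔ ∃ a : Alg ρ, inA ρ a = x := by
  constructor
  · intro h
    exact ⟨x.snd, Unitization.ext (Eq.symm h) rfl⟩
  · rintro ⟨a, rfl⟩
    exact Unitization.fst_inr R a

lemma img_mul (x y : PathAlgebra R V) : img ρ (x * y) = img ρ x * img ρ y :=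
  inA_mul ρ (proj ρ x) (proj ρ y)

instance : (idealJ ρ).IsTwoSided := ⟨fun {a} b ha => by
  refine Submodule.span_induction (p := fun a _ => a * b ∈ idealJ ρ) ?_ ?_ ?_ ?_ ha
  · rintro _ ⟨x, hx, rfl⟩
    obtain ⟨r, b, rfl⟩ : ∃ r c, b = algebraMap R (Alg1 ρ) r + inA ρ c :=
      ⟨b.fst, b.snd, (Unitization.inl_fst_add_inr_snd_eq b).symm⟩
    obtain ⟨y, rfl⟩ := proj_surjective ρ b
    rw [mul_add, ← Algebra.commutes]
    refine Ideal.add_mem _ (Ideal.mul_mem_left _ _ (Ideal.subset_span ⟨x, hx, rfl⟩)) ?_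
    exact Ideal.subset_span ⟨x * y, mul_mem_pathsGE R hx y, img_mul ρ x y⟩
  · rw [zero_mul]; exact Ideal.zero_mem _
  · intro x y _ _ hx hy
    rw [add_mul]; exact Ideal.add_mem _ hx hy
  · intro c x _ hx
    rw [smul_eq_mul, mul_assoc]; exact Ideal.mul_mem_left _ _ hx⟩

/-! ### Modules -/

/-- A left `A`-module `M` is unitary if `A M = M`. -/
def unitary : ObjectProperty (ModuleCat.{u} (Alg1 ρ)) := fun M =>
  Submodule.span (Alg1 ρ) {x : M | ∃ (a : Alg ρ) (m : M), inA ρ a • m = x} = ⊤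

/-- The category `A-Mod` of unitary left `A`-modules. -/
abbrev AMod : Type (u + 1) := (unitary ρ).FullSubcategory

/-- The sum of the vertices in `s`, as an element of `A¹`. -/
noncomputable def eSum (s : Finset V) : Alg1 ρ := img ρ (∑ i ∈ s, vertex R i)

lemma exists_eSum_mul (a : Alg ρ) :
    ∃ s : Finset V, ∀ t : Finset V, s ⊆ t → eSum ρ t * inA ρ a = inA ρ a := by
  obtain ⟨x, rfl⟩ := proj_surjective ρ a
  obtain ⟨s, hs⟩ := exists_local_unit x
  refine ⟨s, fun t ht => ?_⟩
  rw [eSum, img, ← inA_mul, ← proj_mul, hs t ht]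

lemma unitary_iff (M : ModuleCat.{u} (Alg1 ρ)) :
    unitary ρ M ↔ ∀ m : M, ∃ s : Finset V, ∀ t : Finset V, s ⊆ t → eSum ρ t • m = m := by
  classical
  constructor
  · intro h m
    have hm : m ∈ Submodule.span (Alg1 ρ) {x : M | ∃ (a : Alg ρ) (m : M), inA ρ a • m = x} := by
      rw [show _ = _ from h]; trivial
    refine Submodule.span_induction ?_ ⟨∅, by simp⟩ ?_ ?_ hm
    · rintro _ ⟨a, m, rfl⟩
      obtain ⟨s, hs⟩ := exists_eSum_mul ρ a
      exact ⟨s, fun t ht => by rw [← mul_smul, hs t ht]⟩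
    · rintro x y _ _ ⟨s, hs⟩ ⟨s', hs'⟩
      refine ⟨s ∪ s', fun t ht => ?_⟩
      rw [smul_add, hs t (Finset.union_subset_left ht), hs' t (Finset.union_subset_right ht)]
    · rintro b x _ ⟨s, hs⟩
      have hmem : b * eSum ρ s ∈ idealA ρ :=
        (idealA ρ).mul_mem_left b ((mem_idealA ρ).2 ⟨_, rfl⟩)
      obtain ⟨a, ha⟩ := (mem_idealA ρ).1 hmem
      obtain ⟨s', hs'⟩ := exists_eSum_mul ρ a
      refine ⟨s', fun t ht => ?_⟩
      rw [← hs s (Finset.Subset.refl s), ← mul_smul b, ← ha, ← mul_smul, hs' t ht]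
  · intro h
    refine eq_top_iff.2 fun m _ => ?_
    obtain ⟨s, hs⟩ := h m
    exact Submodule.subset_span ⟨_, m, hs s (Finset.Subset.refl s)⟩

instance : (unitary ρ).IsClosedUnderSubobjects where
  prop_of_mono {X Y} f hf hY := by
    rw [unitary_iff] at hY ⊢
    intro m
    obtain ⟨s, hs⟩ := hY (f.hom m)
    refine ⟨s, fun t ht => (ModuleCat.mono_iff_injective f).1 hf ?_⟩
    rw [map_smul]
    exact hs t ht

instance : (unitary ρ).IsClosedUnderQuotients where
  prop_of_epi {X Y} f hf hX := by
    rw [unitary_iff] at hX ⊢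
    intro m
    obtain ⟨m, rfl⟩ := (ModuleCat.epi_iff_surjective f).1 hf m
    obtain ⟨s, hs⟩ := hX m
    refine ⟨s, fun t ht => ?_⟩
    rw [← map_smul, hs t ht]

instance : (unitary ρ).ContainsZero where
  exists_zero := ⟨ModuleCat.of _ PUnit, ModuleCat.isZero_of_subsingleton _,
    (unitary_iff ρ _).2 fun _ => ⟨∅, fun _ _ => Subsingleton.elim _ _⟩⟩

instance : (unitary ρ).IsClosedUnderFiniteProducts where
  isClosedUnderLimitsOfShape J _ := ⟨by
    classical
    have := Fintype.ofFinite J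
    rintro X ⟨p⟩
    rw [unitary_iff]
    intro m
    have h := fun j => (unitary_iff ρ _).1 (p.prop_diag_obj j)
    choose s hs using fun j : J => h ⟨j⟩ ((p.π.app ⟨j⟩).hom m)
    refine ⟨Finset.univ.biUnion s, fun t ht => ?_⟩
    refine Concrete.isLimit_ext _ p.isLimit _ _ fun ⟨j⟩ => ?_
    refine Eq.trans ((p.π.app ⟨j⟩).hom.map_smul _ _) (hs j t ?_)
    exact (Finset.subset_biUnion_of_mem s (Finset.mem_univ j)).trans ht⟩

/-- The object of `A-Mod` given by a quotient `L / K` of left ideals `K ⊆ L ⊆ A`. -/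
noncomputable def AMod.quot (L K : Ideal (Alg1 ρ)) (hL : L ≤ idealA ρ) : AMod ρ :=
  ⟨ModuleCat.of (Alg1 ρ) (L ⧸ K.submoduleOf L), (unitary_iff ρ _).2 fun m => by
    obtain ⟨⟨m, hm⟩, rfl⟩ := Submodule.Quotient.mk_surjective _ m
    obtain ⟨a, rfl⟩ := (mem_idealA ρ).1 (hL hm)
    obtain ⟨s, hs⟩ := exists_eSum_mul ρ a
    refine ⟨s, fun t ht => ?_⟩
    refine congrArg (Submodule.Quotient.mk (p := K.submoduleOf L)) (Subtype.ext ?_)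
    exact hs t ht⟩

/-- For a left ideal `L`, the left ideal `L e_i = {x e_i | x ∈ L}`. -/
noncomputable def mulE (L : Ideal (Alg1 ρ)) (i : V) : Ideal (Alg1 ρ) :=
  Submodule.map (LinearMap.toSpanSingleton (Alg1 ρ) (Alg1 ρ) (idem ρ i)) L

lemma mulE_idealA_le (i : V) : mulE ρ (idealA ρ) i ≤ idealA ρ := by
  rintro _ ⟨x, -, rfl⟩
  exact (idealA ρ).mul_mem_left x ((mem_idealA ρ).2 ⟨_, rfl⟩)

/-- The torsion radical: `t(M)` consists of the elements that are annihilated by some power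
of `J`. -/
noncomputable def torsionRadical (M : Type u) [AddCommGroup M] [Module (Alg1 ρ) M] :
    Submodule (Alg1 ρ) M where
  carrier := {x | ∃ n : ℕ, ∀ a ∈ idealJ ρ ^ n, a • x = 0}
  zero_mem' := ⟨0, fun a _ => smul_zero a⟩
  add_mem' := by
    rintro x y ⟨m, hm⟩ ⟨n, hn⟩
    refine ⟨m + n, fun a ha => ?_⟩
    rw [smul_add, hm a (Ideal.pow_le_pow_right (Nat.le_add_right m n) ha),
      hn a (Ideal.pow_le_pow_right (Nat.le_add_left n m) ha), add_zero]
  smul_mem' := by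
    rintro b x ⟨n, hn⟩
    refine ⟨n, fun a ha => ?_⟩
    rw [← mul_smul]
    exact hn _ (Ideal.mul_mem_right b _ ha)

/-- `t(A)`, as a left ideal of `A¹` contained in `A`. -/
noncomputable def torsionA : Ideal (Alg1 ρ) := torsionRadical ρ (Alg1 ρ) ⊓ idealA ρ

/-- The class `𝒯` of torsion modules in `A-Mod`: every element is annihilated by some power
of `J`. -/
def torsion : ObjectProperty (AMod ρ) := fun M => ∀ x : M.obj, x ∈ torsionRadical ρ M.obj

/-- The left `A`-module `B e_i = R e_i`, on which `A` acts through the projection `A → A / J = B`,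
so that `B e_i = A e_i / J e_i`. -/
noncomputable def moduleBe (i : V) : AMod ρ :=
  AMod.quot ρ (mulE ρ (idealA ρ) i) (mulE ρ (idealJ ρ) i) (mulE_idealA_le ρ i)

/-- The left `A`-module `A e_j / t(A) e_j`. -/
noncomputable def moduleAeModTorsion (j : V) : AMod ρ :=
  AMod.quot ρ (mulE ρ (idealA ρ) j) (mulE ρ (torsionA ρ) j) (mulE_idealA_le ρ j)

/-- The morphisms of `A-Mod` with torsion kernel and torsion cokernel. -/
def torsionIso : MorphismProperty (AMod ρ) :=
  fun _ _ f => torsion ρ (kernel f) ∧ torsion ρ (cokernel f)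

/-- The quotient category `A-Mod / 𝒯`: the localization of `A-Mod` at the morphisms with torsion
kernel and torsion cokernel. -/
abbrev AModModTorsion : Type (u + 1) := (torsionIso ρ).Localization

end Algebra

/-! ### Categories -/

section Categories

/-- `Ext¹(X, Y) = 0`. -/
def ExtOneVanishes {C : Type u} [Category.{v} C] [Abelian C] (X Y : C) : Prop :=
  letI := HasExt.standard C
  Subsingleton (Abelian.Ext.{max u v} X Y 1)

/-- The category `C` is a Grothendieck category (with respect to the universe `w`). An abelian
structure on a category is unique, so that it does not matter which one is taken. -/
def IsGrothendieckCategory (C : Type u) [Category.{v} C] : Prop :=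
  ∃ _ : Abelian C, IsGrothendieckAbelian.{w} C

/-- `p` is a pure epimorphism: every morphism from a finitely presented object to its target lifts
along `p`. -/
def IsPureEpi {C : Type u} [Category.{v} C] {M N : C} (p : M ⟶ N) : Prop :=
  Epi p ∧ ∀ (X : C), IsFinitelyPresentable.{w} X → ∀ f : X ⟶ N, ∃ g : X ⟶ M, g ≫ p = f

/-- `F` is flat: every epimorphism with target `F` is pure. -/
def IsFlatObject {C : Type u} [Category.{v} C] (F : C) : Prop :=
  ∀ (M : C) (p : M ⟶ F), Epi p → IsPureEpi.{w} p

/-- Every flat object of `C` is zero. -/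
def HasNoNonzeroFlats (C : Type u) [Category.{v} C] : Prop :=
  ∀ F : C, IsFlatObject.{w} F → IsZero F

end Categories

end QuiverRel

open QuiverRel

/-! Everything rests on finite generation at a vertex. Peeling off last arrows shows that each `J^n
e_i` is finitely generated, so `A e_i / J^n e_i` is finitely presented, and comparing last arrows
modulo ⟨ρ⟩ shows that `J e_i` is finitely presented (`ker_arrowsLin`). Finite generation also makes
torsion closed under extensions (`saturation_saturation`). An abelian category with a small
separating set of finitely presentable objects is locally finitely presentable, and then AB5 and a
separator come for free.

For the torsion category the modules `A e_i / J^n e_i` separate. Let F be flat and torsion, and let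
`J^n` kill `e_i x`. Paths starting at `i` have length at most some L. Cover F by a direct sum of
modules `A e_j / J^m e_j` with all m > n + L and lift `A e_i / J^n e_i → F` to it. A component of
the lift is given by some c = e_i c with `J^n c ⊆ J^m e_j`. For a path p of length n, p c is
represented in degrees at most n + L < m, so by homogeneity p c = 0. Hence c lies in t(A) = 0, the
lift vanishes, and e_i x = 0.

For the quotient, call a module torsion-closed if it is torsion-free and has the extension property
along `J e_i ⊆ A e_i`. These are the local objects for maps between finitely presentable objects, so
they form a reflective, locally finitely presentable subcategory. The reflection inverts exactly the
maps with torsion kernel and cokernel (`isLocal_isLocal_inclusions`), whence the equivalence with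
the localization. The Ext condition makes each `A e_k / t(A) e_k` torsion-closed, and direct sums
preserve this because `J e_i` is finitely generated. Given F flat, let M be a direct sum of such
modules over vertices k with i ⋠ k, mapping to F by all elements of F. Narrowness makes intervals
finite, so long paths into any j start outside the successors of i; thus M → F has torsion cokernel
and is an epimorphism of torsion-closed modules. The map from the reflection of `A e_i` to F given
by x lifts to M, but e_i M = 0, so e_i x = 0. -/

namespace QuiverRel

/-! ### Locally finitely presentable abelian categories -/

section CategoryLemmas

universe v' u'

attribute [local instance] Cardinal.fact_isRegular_aleph0

/-- A monomorphism through which all maps from a separating class factor is also an epimorphism, and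
abelian categories are balanced. -/
lemma isStrongGenerator_of_isSeparating {C : Type u} [Category.{v} C] [Abelian C]
    {P : ObjectProperty C} (hP : P.IsSeparating) : P.IsStrongGenerator := by
  rw [ObjectProperty.isStrongGenerator_iff]
  refine ⟨hP, fun X Y i _ hi => ?_⟩
  have : Epi i := Preadditive.epi_of_cancel_zero _ fun h hh => by
    refine hP _ _ fun G hG k => ?_
    obtain ⟨f, rfl⟩ := hi G hG k
    simp [hh]
  exact isIso_of_mono_of_epi i

lemma isLocallyFinitelyPresentable_of_isSeparating {C : Type u} [Category.{v} C] [Abelian C]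
    [LocallySmall.{w} C] [HasColimitsOfSize.{w, w} C] (P : ObjectProperty C)
    [ObjectProperty.Small.{w} P] (hP : P.IsSeparating)
    (hfp : ∀ X, P X → IsFinitelyPresentable.{w} X) : IsLocallyFinitelyPresentable.{w} C :=
  (IsCardinalLocallyPresentable.iff_exists_isStrongGenerator C Cardinal.aleph0).2
    ⟨P, inferInstance, isStrongGenerator_of_isSeparating hP, hfp⟩

/-- Exactness of filtered colimits is tested on finitely presentable X: a map from X to the colimit
of F lives at some stage, and if it dies in the colimit of G it dies at a later stage of G. Since φ
is mono there, it already died in F. -/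
lemma mono_colimMap_of_isLocallyFinitelyPresentable {C : Type u} [Category.{v} C] [Abelian C]
    [IsLocallyFinitelyPresentable.{w} C] {J : Type w} [SmallCategory J] [IsFiltered J]
    {F G : J ⥤ C} (φ : F ⟶ G) [∀ j, Mono (φ.app j)] : Mono (colimMap φ) := by
  obtain ⟨P, _, hP, hfp⟩ :=
    (IsCardinalLocallyPresentable.iff_exists_isStrongGenerator C Cardinal.aleph0).1 inferInstance
  refine Preadditive.mono_of_cancel_zero _ fun {Z} h hh => hP.isSeparating _ _ fun X hX k => ?_
  have : IsFinitelyPresentable.{w} X := hfp X hX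
  obtain ⟨j, p, hp⟩ := IsFinitelyPresentable.exists_hom_of_isColimit (colimit.isColimit F) (k ≫ h)
  have h0 : (p ≫ φ.app j) ≫ (colimit.cocone G).ι.app j = 0 ≫ (colimit.cocone G).ι.app j := by
    have : (k ≫ h) ≫ colimMap φ = 0 := by simp [hh]
    rw [← hp] at this
    simpa using this
  obtain ⟨i, a, b, hab⟩ := IsFinitelyPresentable.exists_eq_of_isColimit (colimit.isColimit G) _ _ h0
  have h1 : p ≫ F.map a = 0 := by
    rw [← cancel_mono (φ.app i)]
    simpa using hab
  rw [comp_zero, ← hp, ← (colimit.cocone F).w a, ← Category.assoc, h1, zero_comp]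

/-- An abelian locally finitely presentable category is a Grothendieck category. -/
theorem isGrothendieckAbelian_of_isLocallyFinitelyPresentable (C : Type u) [Category.{v} C]
    [Abelian C] [h : IsLocallyFinitelyPresentable.{w} C] : IsGrothendieckAbelian.{w} C where
  locallySmall := h.toHasCardinalFilteredGenerator.toLocallySmall
  ab5OfSize := ⟨fun J _ _ => by
    have : (colim (J := J) (C := C)).PreservesMonomorphisms := ⟨fun φ _ =>
      have : ∀ j, Mono (φ.app j) := inferInstance
      mono_colimMap_of_isLocallyFinitelyPresentable φ⟩
    exact hasExactColimitsOfShape_of_preservesMono C J⟩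
  hasSeparator := by
    obtain ⟨P, _, hP, hfp⟩ :=
      (IsCardinalLocallyPresentable.iff_exists_isStrongGenerator C Cardinal.aleph0).1 ‹_›
    have : HasCoproductsOfShape (Subtype P) C :=
      hasColimitsOfShape_of_equivalence (Discrete.equivalence (equivShrink.{w} (Subtype P)).symm)
    refine ⟨⟨∐ fun X : Subtype P => X.1, (isSeparator_sigma _).2 ?_⟩⟩
    exact ObjectProperty.IsSeparating.of_le hP.isSeparating fun X hX => by simpa using hX

/-- A property of objects for which every object has a largest subobject with this property is
closed under colimits. -/
lemma isClosedUnderColimitsOfShape_of_exists_mono {C : Type u} [Category.{v} C]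
    (P : ObjectProperty C) [P.IsClosedUnderIsomorphisms]
    (h : ∀ X : C, ∃ (K : C) (r : K ⟶ X), P K ∧ Mono r ∧
      ∀ (Y : C) (f : Y ⟶ X), P Y → ∃ g : Y ⟶ K, g ≫ r = f)
    (J : Type u') [Category.{v'} J] : P.IsClosedUnderColimitsOfShape J where
  colimitsOfShape_le := by
    rintro X ⟨p⟩
    obtain ⟨K, r, hK, _, hr⟩ := h X
    choose g hg using fun j => hr _ (p.ι.app j) (p.prop_diag_obj j)
    have hn : ∀ i j (a : i ⟶ j), p.diag.map a ≫ g j = g i := fun i j a => by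
      rw [← cancel_mono r, Category.assoc, hg, hg]
      simp
    let c : Cocone p.diag := Cocone.mk K { app := g, naturality := fun i j a => by simp [hn] }
    have hs : p.isColimit.desc c ≫ r = 𝟙 X := p.isColimit.hom_ext fun j => by
      rw [p.isColimit.fac_assoc, Category.comp_id]
      exact hg j
    -- The colimit factors through its own largest subobject, which is therefore everything.
    have : IsSplitEpi r := ⟨⟨⟨_, hs⟩⟩⟩
    have := isIso_of_mono_of_isSplitEpi r
    exact P.prop_of_iso (asIso r) hK

/-- Finitely presentable objects of a full subcategory closed under filtered colimits. -/
lemma isFinitelyPresentable_fullSubcategory {C : Type u} [Category.{v} C]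
    [HasColimitsOfSize.{w, w} C] (P : ObjectProperty C)
    [∀ (J : Type w) [SmallCategory J], P.IsClosedUnderColimitsOfShape J]
    (X : P.FullSubcategory) [IsFinitelyPresentable.{w} X.obj] : IsFinitelyPresentable.{w} X := by
  have : P.ι.IsCardinalAccessible Cardinal.aleph0.{w} := ⟨fun J _ _ => inferInstance⟩
  -- The inclusion preserves filtered colimits, and by full faithfulness Hom(X, -) is its composite
  -- with the ambient Hom functor.
  let e : P.ι ⋙ coyoneda.obj (Opposite.op X.obj) ≅ coyoneda.obj (Opposite.op X) :=
    NatIso.ofComponents (fun Y => (P.fullyFaithfulι.homEquiv (X := X) (Y := Y)).symm.toIso)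
      (fun f => by ext; rfl)
  exact Functor.isCardinalAccessible_of_natIso e _

lemma isZero_of_isZero_obj {C : Type u} [Category.{v} C] {D : Type u'} [Category.{v'} D]
    (F : C ⥤ D) [F.Full] [F.Faithful] {X : C} (h : IsZero (F.obj X)) : IsZero X where
  unique_to _ := ⟨⟨⟨F.preimage (h.to_ _)⟩, fun _ => F.map_injective (h.eq_of_src _ _)⟩⟩
  unique_from _ := ⟨⟨⟨F.preimage (h.from_ _)⟩, fun _ => F.map_injective (h.eq_of_tgt _ _)⟩⟩

lemma HasNoNonzeroFlats.of_equivalence {C : Type u} [Category.{v} C] {D : Type u'}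
    [Category.{v'} D] (e : C ≌ D) (h : HasNoNonzeroFlats.{w} C) : HasNoNonzeroFlats.{w} D := by
  intro F hF
  refine isZero_of_isZero_obj e.inverse (h _ fun M p hp => ⟨hp, fun X hX f => ?_⟩)
  have : IsFinitelyPresentable.{w} (e.functor.obj X) :=
    isCardinalPresentable_of_equivalence X _ e
  obtain ⟨-, hq⟩ := hF _ (e.functor.map p ≫ e.counit.app F) inferInstance
  obtain ⟨g, hg⟩ := hq _ this (e.functor.map f ≫ e.counit.app F)
  refine ⟨e.functor.preimage g, e.functor.map_injective ?_⟩
  rw [← cancel_mono (e.counit.app F)]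
  simpa using hg

/-- S corepresents the forgetful functor, which preserves filtered colimits. -/
lemma isFinitelyPresentable_self (S : Type u) [Ring S] :
    IsFinitelyPresentable.{u} (ModuleCat.of S S) := by
  rw [isFinitelyPresentable_iff_preservesFilteredColimits]
  let e : forget (ModuleCat.{u} S) ≅ coyoneda.obj (Opposite.op (ModuleCat.of S S)) :=
    NatIso.ofComponents (fun M => Equiv.toIso
      ⟨fun m => ModuleCat.ofHom (LinearMap.toSpanSingleton S M m), fun f => f.hom (1 : S),
        fun m => by simp, fun f => ModuleCat.hom_ext (LinearMap.ext_ring (by simp))⟩)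
      (fun f => by ext m; exact ModuleCat.hom_ext (LinearMap.ext_ring (by simp)))
  exact ⟨fun J _ _ => preservesColimitsOfShape_of_natIso e⟩

/-- Finitely presented modules are finitely presentable objects of the category of modules. -/
lemma isFinitelyPresentable_of_finitePresentation {S : Type u} [Ring S] (M : ModuleCat.{u} S)
    [h : Module.FinitePresentation S M] : IsFinitelyPresentable.{u} M := by
  have hfree (n : ℕ) : IsFinitelyPresentable.{u} (ModuleCat.of S (Fin n → S)) := by
    have := isClosedUnderColimitsOfShape_isCardinalPresentable (ModuleCat.{u} S)
      (κ := Cardinal.aleph0.{u}) (J := Discrete (Fin n))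
      ((hasCardinalLT_aleph0_iff _).2 inferInstance)
    have := (isCardinalPresentable (ModuleCat.{u} S) Cardinal.aleph0.{u}).prop_of_isColimit
      (biproduct.isColimit fun _ : Fin n => ModuleCat.of S S)
      fun _ => isFinitelyPresentable_self S
    exact (isCardinalPresentable (ModuleCat.{u} S) Cardinal.aleph0.{u}).prop_of_iso
      (ModuleCat.biproductIsoPi fun _ : Fin n => ModuleCat.of S S) this
  obtain ⟨n, m, f, g, hf, hfg⟩ := Module.FinitePresentation.exists_fin' S M
  have := isClosedUnderColimitsOfShape_isCardinalPresentable (ModuleCat.{u} S)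
    (κ := Cardinal.aleph0.{u}) (J := WalkingParallelPair)
    ((hasCardinalLT_aleph0_iff _).2 inferInstance)
  -- M is the cokernel of a map of finite free modules, a finite colimit of finitely presentable
  -- objects.
  refine (isCardinalPresentable (ModuleCat.{u} S) Cardinal.aleph0.{u}).prop_of_isColimit
    (ModuleCat.isColimitCokernelCofork (ModuleCat.ofHom g) (ModuleCat.ofHom f) hfg hf) ?_
  rintro (_ | _)
  exacts [hfree m, hfree n]

end CategoryLemmas

/-! ### Generators of the left ideals J^n e_i -/

section PathElements

variable {V : Type u} [Quiver.{u} V] {R : Type u} [CommRing R] (ρ : Set (PathAlgebra R V))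

lemma inA_injective : Function.Injective (inA ρ) := Unitization.inr_injective

lemma img_add (x y : PathAlgebra R V) : img ρ (x + y) = img ρ x + img ρ y :=
  inA_add ρ (proj ρ x) (proj ρ y)

lemma img_zero : img ρ (0 : PathAlgebra R V) = 0 := Unitization.inr_zero R

lemma img_smul (r : R) (x : PathAlgebra R V) : img ρ (r • x) = r • img ρ x := by
  rw [img, proj_smul]
  exact Unitization.inr_smul R r _

/-- The map `RQ → A¹`, as a linear map. -/
noncomputable def imgLin : PathAlgebra R V →ₗ[R] Alg1 ρ where
  toFun := img ρ
  map_add' := img_add ρ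
  map_smul' := img_smul ρ

lemma imgLin_apply (x : PathAlgebra R V) : imgLin ρ x = img ρ x := rfl

lemma img_eq_zero_iff (x : PathAlgebra R V) : img ρ x = 0 ↔ x ∈ TwoSidedIdeal.span ρ := by
  rw [← img_zero ρ, img, img, (inA_injective ρ).eq_iff, proj_eq_iff, sub_zero]

lemma img_mem_idealA (x : PathAlgebra R V) : img ρ x ∈ idealA ρ := (mem_idealA ρ).2 ⟨_, rfl⟩

lemma exists_img_eq {x : Alg1 ρ} (hx : x ∈ idealA ρ) : ∃ y, img ρ y = x := by
  obtain ⟨a, rfl⟩ := (mem_idealA ρ).1 hx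
  obtain ⟨y, rfl⟩ := proj_surjective ρ a
  exact ⟨y, rfl⟩

/-- The element of `A ⊆ A¹` given by a path. -/
noncomputable def pathElt {i j : V} (p : Quiver.Path i j) : Alg1 ρ := img ρ (ofPath R ⟨i, j, p⟩)

lemma idem_eq_pathElt (i : V) : idem ρ i = pathElt ρ (.nil : Quiver.Path i i) := rfl

lemma pathElt_mul_pathElt {i j k : V} (p : Quiver.Path i j) (q : Quiver.Path j k) :
    pathElt ρ p * pathElt ρ q = pathElt ρ (p.comp q) := by
  rw [pathElt, pathElt, ← img_mul, ofPath_mul_ofPath_of_eq, pathElt]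

lemma pathElt_mul_pathElt_of_ne {i j k l : V} (h : j ≠ k) (p : Quiver.Path i j)
    (q : Quiver.Path k l) : pathElt ρ p * pathElt ρ q = 0 := by
  rw [pathElt, pathElt, ← img_mul, ofPath_mul_ofPath_of_ne R (p := ⟨i, j, p⟩) (q := ⟨k, l, q⟩) h,
    img_zero]

lemma pathElt_mul_idem {i j : V} (p : Quiver.Path i j) : pathElt ρ p * idem ρ j = pathElt ρ p :=
  pathElt_mul_pathElt ρ p .nil

lemma pathElt_mul_idem_of_ne {i j k : V} (h : j ≠ k) (p : Quiver.Path i j) :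
    pathElt ρ p * idem ρ k = 0 :=
  pathElt_mul_pathElt_of_ne ρ h p .nil

lemma idem_mul_pathElt {i j : V} (p : Quiver.Path i j) : idem ρ i * pathElt ρ p = pathElt ρ p := by
  rw [idem_eq_pathElt, pathElt_mul_pathElt, Quiver.Path.nil_comp]

lemma idem_mul_idem (i : V) : idem ρ i * idem ρ i = idem ρ i := pathElt_mul_idem ρ .nil

lemma idem_mem_idealA (i : V) : idem ρ i ∈ idealA ρ := img_mem_idealA ρ _

lemma eSum_eq (s : Finset V) : eSum ρ s = ∑ i ∈ s, idem ρ i :=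
  map_sum (imgLin ρ) _ _

/-- The left ideal `J` is generated by the arrows. -/
lemma idealJ_eq_span :
    idealJ ρ = Ideal.span {x | ∃ (j i : V) (a : j ⟶ i), x = pathElt ρ a.toPath} := by
  refine le_antisymm (Ideal.span_le.2 ?_) (Ideal.span_le.2 ?_)
  · rintro _ ⟨x, hx, rfl⟩
    refine pathsGE_induction (P := fun x => img ρ x ∈ Ideal.span _) hx ?_
      (fun x y hx hy => ?_) (fun r p hp => ?_)
    · rw [img_zero]; exact Ideal.zero_mem _
    · rw [img_add]; exact Ideal.add_mem _ hx hy
    · rw [img_smul, Algebra.smul_def]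
      refine Ideal.mul_mem_left _ _ ?_
      obtain ⟨i, k, _ | ⟨p, a⟩⟩ := p
      · simp [len] at hp
      · have : img ρ (ofPath R ⟨i, k, p.cons a⟩) = pathElt ρ p * pathElt ρ a.toPath :=
          (pathElt_mul_pathElt ρ p a.toPath).symm
        rw [this]
        exact Ideal.mul_mem_left _ _ (Ideal.subset_span ⟨_, _, a, rfl⟩)
  · rintro _ ⟨j, i, a, rfl⟩
    exact Ideal.subset_span ⟨_, ofPath_mem_pathsGE R (p := ⟨j, i, a.toPath⟩) (by simp [len]), rfl⟩

lemma idealJ_le_idealA : idealJ ρ ≤ idealA ρ := by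
  refine Ideal.span_le.2 ?_
  rintro _ ⟨x, -, rfl⟩
  exact img_mem_idealA ρ x

lemma pathElt_mem_idealJ_pow {i j : V} (p : Quiver.Path i j) :
    pathElt ρ p ∈ idealJ ρ ^ p.length := by
  induction p with
  | nil => rw [Quiver.Path.length_nil, Submodule.pow_zero, Ideal.one_eq_top]; trivial
  | cons p a ih =>
    have : pathElt ρ (p.cons a) = pathElt ρ p * pathElt ρ a.toPath :=
      (pathElt_mul_pathElt ρ p a.toPath).symm
    rw [this, Quiver.Path.length_cons, Submodule.pow_succ]
    refine Ideal.mul_mem_mul ih ?_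
    rw [idealJ_eq_span]
    exact Ideal.subset_span ⟨_, _, a, rfl⟩

lemma mul_idem_of_mem_mulE {L : Ideal (Alg1 ρ)} {i : V} {x : Alg1 ρ} (h : x ∈ mulE ρ L i) :
    x * idem ρ i = x := by
  obtain ⟨y, -, rfl⟩ := h
  rw [LinearMap.toSpanSingleton_apply, smul_eq_mul, mul_assoc, idem_mul_idem]

lemma mulE_mono {L L' : Ideal (Alg1 ρ)} (h : L ≤ L') (i : V) : mulE ρ L i ≤ mulE ρ L' i :=
  Submodule.map_mono h

lemma mul_idem_mem_mulE {L : Ideal (Alg1 ρ)} {x : Alg1 ρ} (hx : x ∈ L) (i : V) :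
    x * idem ρ i ∈ mulE ρ L i := ⟨x, hx, rfl⟩

lemma mulE_le (L : Ideal (Alg1 ρ)) [L.IsTwoSided] (i : V) : mulE ρ L i ≤ L := by
  rintro _ ⟨x, hx, rfl⟩
  exact Ideal.mul_mem_right _ _ hx

lemma mem_mulE_idealA {i : V} {x : Alg1 ρ} : x ∈ mulE ρ (idealA ρ) i ↔ x * idem ρ i = x := by
  refine ⟨mul_idem_of_mem_mulE ρ, fun h => ⟨x * idem ρ i, ?_, ?_⟩⟩
  · exact Ideal.mul_mem_left _ _ (idem_mem_idealA ρ i)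
  · rw [LinearMap.toSpanSingleton_apply, smul_eq_mul, h, h]

lemma idem_mem_mulE_idealA (i : V) : idem ρ i ∈ mulE ρ (idealA ρ) i :=
  (mem_mulE_idealA ρ).2 (idem_mul_idem ρ i)

/-- The left ideal `J e_i` is generated by the arrows with terminus `i`. -/
lemma mulE_idealJ_eq_span (i : V) :
    mulE ρ (idealJ ρ) i =
      Submodule.span (Alg1 ρ) (Set.range fun a : Quiver.Costar i => pathElt ρ a.2.toPath) := by
  rw [mulE, idealJ_eq_span, Ideal.span, Submodule.map_span]
  refine le_antisymm (Submodule.span_le.2 ?_) (Submodule.span_le.2 ?_)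
  · rintro _ ⟨_, ⟨j, k, a, rfl⟩, rfl⟩
    rw [LinearMap.toSpanSingleton_apply, smul_eq_mul]
    by_cases h : k = i
    · subst h
      rw [pathElt_mul_idem]
      exact Submodule.subset_span ⟨⟨j, a⟩, rfl⟩
    · rw [pathElt_mul_idem_of_ne ρ h]
      exact Submodule.zero_mem _
  · rintro _ ⟨⟨j, a⟩, rfl⟩
    exact Submodule.subset_span ⟨_, ⟨j, i, a, rfl⟩, pathElt_mul_idem ρ _⟩

/-- Peeling off the last arrow lowers the exponent by one. In a locally finite quiver this recursion
carries finite generation from n to n + 1. -/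
lemma mulE_idealJ_pow_succ (n : ℕ) (i : V) :
    mulE ρ (idealJ ρ ^ (n + 1)) i = ⨆ a : Quiver.Costar i,
      Submodule.map (LinearMap.toSpanSingleton (Alg1 ρ) (Alg1 ρ) (pathElt ρ a.2.toPath))
        (mulE ρ (idealJ ρ ^ n) a.1) := by
  refine le_antisymm ?_ (iSup_le fun a => ?_)
  · rintro _ ⟨x, hx, rfl⟩
    rw [LinearMap.toSpanSingleton_apply, smul_eq_mul]
    rw [SetLike.mem_coe, Submodule.pow_succ] at hx
    refine Submodule.mul_induction_on (C := fun x => x * idem ρ i ∈ _) hx ?_ ?_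
    · intro u hu v hv
      rw [mul_assoc]
      have hv' := mul_idem_mem_mulE ρ hv i
      rw [mulE_idealJ_eq_span] at hv'
      generalize v * idem ρ i = w at hv'
      -- The left factor has to vary in the induction: for a multiple c x, the scalar moves into u
      -- c, which stays in the two-sided ideal `J^n`.
      revert u
      refine Submodule.span_induction (p := fun w _ => ∀ u ∈ idealJ ρ ^ n, u * w ∈ _)
        ?_ ?_ ?_ ?_ hv'
      · rintro _ ⟨a, rfl⟩ u hu
        refine Submodule.mem_iSup_of_mem a ⟨u * idem ρ a.1, mul_idem_mem_mulE ρ hu _, ?_⟩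
        rw [LinearMap.toSpanSingleton_apply, smul_eq_mul, mul_assoc, idem_mul_pathElt]
      · intro u _
        rw [mul_zero]; exact Submodule.zero_mem _
      · intro x y _ _ hx hy u hu
        rw [mul_add]; exact Submodule.add_mem _ (hx u hu) (hy u hu)
      · intro c x _ hx u hu
        rw [smul_eq_mul, ← mul_assoc]; exact hx _ (Ideal.mul_mem_right _ _ hu)
    · intro x y hx hy
      rw [add_mul]; exact Submodule.add_mem _ hx hy
  · rintro _ ⟨_, ⟨x, hx, rfl⟩, rfl⟩
    simp only [LinearMap.toSpanSingleton_apply, smul_eq_mul]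
    rw [mul_assoc, idem_mul_pathElt, ← pathElt_mul_idem, ← mul_assoc]
    refine mul_idem_mem_mulE ρ ?_ i
    rw [Submodule.pow_succ]
    refine Ideal.mul_mem_mul hx ?_
    simpa [Submodule.pow_one] using pathElt_mem_idealJ_pow ρ a.2.toPath

lemma fg_mulE_idealA (i : V) : (mulE ρ (idealA ρ) i).FG := by
  refine ⟨{idem ρ i}, le_antisymm ?_ ?_⟩
  · rw [Submodule.span_le]
    simpa using idem_mem_mulE_idealA ρ i
  · intro x hx
    rw [← mul_idem_of_mem_mulE ρ hx]
    exact Submodule.smul_mem _ x (Submodule.subset_span (by simp))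

lemma fg_mulE_idealJ_pow (hfin : IsLocallyFiniteQuiver V) (n : ℕ) (i : V) :
    (mulE ρ (idealJ ρ ^ n) i).FG := by
  induction n generalizing i with
  | zero =>
    -- The power `J^0` is all of A¹, not A, but A¹ e_i = A e_i.
    convert! fg_mulE_idealA ρ i using 1
    refine le_antisymm ?_ (mulE_mono ρ (by rw [Submodule.pow_zero, Ideal.one_eq_top]; exact le_top) i)
    rintro _ ⟨x, -, rfl⟩
    exact (mem_mulE_idealA ρ).2 (by
      rw [LinearMap.toSpanSingleton_apply, smul_eq_mul, mul_assoc, idem_mul_idem])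
  | succ n ih =>
    rw [mulE_idealJ_pow_succ]
    have := (hfin i).2
    exact Submodule.fg_iSup _ fun a => Submodule.FG.map _ (ih a.1)

end PathElements

/-! ### Unitary modules and saturation of submodules -/

section Saturation

variable {V : Type u} [Quiver.{u} V] {R : Type u} [CommRing R] (ρ : Set (PathAlgebra R V))

variable (M : Type u) [AddCommGroup M] [Module (Alg1 ρ) M]

/-- The largest unitary submodule. -/
noncomputable def unitaryPart : Submodule (Alg1 ρ) M where
  carrier := {m | ∃ s : Finset V, ∀ t : Finset V, s ⊆ t → eSum ρ t • m = m}
  zero_mem' := ⟨∅, fun _ _ => smul_zero _⟩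
  add_mem' := by
    classical
    rintro x y ⟨s, hs⟩ ⟨s', hs'⟩
    refine ⟨s ∪ s', fun t ht => ?_⟩
    rw [smul_add, hs t (Finset.union_subset_left ht), hs' t (Finset.union_subset_right ht)]
  smul_mem' := by
    rintro b x ⟨s, hs⟩
    have hmem : b * eSum ρ s ∈ idealA ρ := (idealA ρ).mul_mem_left b (img_mem_idealA ρ _)
    obtain ⟨a, ha⟩ := (mem_idealA ρ).1 hmem
    obtain ⟨s', hs'⟩ := exists_eSum_mul ρ a
    refine ⟨s', fun t ht => ?_⟩
    rw [← hs s (Finset.Subset.refl s), ← mul_smul b, ← ha, ← mul_smul, hs' t ht]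

lemma unitary_of_iff : unitary ρ (ModuleCat.of (Alg1 ρ) M) ↔ unitaryPart ρ M = ⊤ :=
  (unitary_iff ρ _).trans (Submodule.eq_top_iff' (p := unitaryPart ρ M)).symm

variable {M} {ρ} in
-- An element of a unitary module is a finite sum of its components e_i x. This localizes arguments
-- at one vertex, where J^n e_i can be finitely generated even though J^n is not.
lemma mem_of_idem_smul_mem (hM : unitaryPart ρ M = ⊤) {N : Submodule (Alg1 ρ) M} {x : M}
    (h : ∀ i, idem ρ i • x ∈ N) : x ∈ N := by
  obtain ⟨s, hs⟩ : x ∈ unitaryPart ρ M := hM ▸ Submodule.mem_top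
  rw [← hs s (Finset.Subset.refl s), eSum_eq, Finset.sum_smul]
  exact Submodule.sum_mem _ fun i _ => h i

variable {M} {ρ} in
/-- The elements `x` with `J ^ n x ⊆ N` for some `n`. -/
noncomputable def saturation (N : Submodule (Alg1 ρ) M) : Submodule (Alg1 ρ) M where
  carrier := {x | ∃ n : ℕ, ∀ a ∈ idealJ ρ ^ n, a • x ∈ N}
  zero_mem' := ⟨0, fun a _ => by rw [smul_zero]; exact N.zero_mem⟩
  add_mem' := by
    rintro x y ⟨m, hm⟩ ⟨n, hn⟩
    refine ⟨m + n, fun a ha => ?_⟩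
    rw [smul_add]
    exact N.add_mem (hm a (Ideal.pow_le_pow_right (Nat.le_add_right m n) ha))
      (hn a (Ideal.pow_le_pow_right (Nat.le_add_left n m) ha))
  smul_mem' := by
    rintro b x ⟨n, hn⟩
    refine ⟨n, fun a ha => ?_⟩
    rw [← mul_smul]
    exact hn _ (Ideal.mul_mem_right b _ ha)

variable {M} {ρ}

lemma torsionRadical_eq : torsionRadical ρ M = saturation ⊥ := rfl

lemma le_saturation (N : Submodule (Alg1 ρ) M) : N ≤ saturation N :=
  fun _ hx => ⟨0, fun a _ => N.smul_mem a hx⟩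

/-- For each generator g of J^n e_i some power of J carries g x into N; there are finitely many
generators, so one power serves them all. For N = ⊥ this says that torsion is closed under
extensions. -/
lemma saturation_saturation (hfin : IsLocallyFiniteQuiver V) (hM : unitaryPart ρ M = ⊤)
    (N : Submodule (Alg1 ρ) M) : saturation (saturation N) ≤ saturation N := by
  rintro x ⟨n, hn⟩
  refine mem_of_idem_smul_mem hM fun i => ?_
  obtain ⟨s, hs⟩ := fg_mulE_idealJ_pow ρ hfin n i
  have hsx : ∀ g ∈ s, g • x ∈ saturation N := fun g hg => hn g
    (mulE_le ρ (idealJ ρ ^ n) i (hs ▸ Submodule.subset_span hg))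
  choose! k hk using hsx
  -- J^n brings e_i x to combinations of the g x, and the largest of the exponents k g brings those
  -- into N.
  refine ⟨s.sup k + n, fun a ha => ?_⟩
  rw [Ideal.IsTwoSided.pow_add] at ha
  refine Submodule.mul_induction_on (C := fun a => a • idem ρ i • x ∈ N) ha ?_ ?_
  · intro b hb c hc
    rw [← mul_smul, mul_assoc]
    have hc' := mul_idem_mem_mulE ρ hc i
    generalize c * idem ρ i = d at hc'
    rw [← hs] at hc'
    revert b
    refine Submodule.span_induction
      (p := fun d _ => ∀ b ∈ idealJ ρ ^ s.sup k, (b * d) • x ∈ N) ?_ ?_ ?_ ?_ hc'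
    · intro g hg b hb
      rw [mul_smul]
      exact hk g hg b (Ideal.pow_le_pow_right (Finset.le_sup hg) hb)
    · intro b _
      rw [mul_zero, zero_smul]; exact N.zero_mem
    · intro c d _ _ hc hd b hb
      rw [mul_add, add_smul]; exact N.add_mem (hc b hb) (hd b hb)
    · intro r d _ hd b hb
      rw [smul_eq_mul, ← mul_assoc]
      exact hd _ (Ideal.mul_mem_right _ _ hb)
  · intro a b ha hb
    rw [add_smul]; exact N.add_mem ha hb

/-- Membership of the saturation can be climbed down one factor J at a time, so a statement about
all powers reduces to one about the ideals J e_i. -/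
lemma saturation_le_of_forall (hM : unitaryPart ρ M = ⊤) {N N' : Submodule (Alg1 ρ) M}
    (hN : N ≤ N') (h : ∀ (i : V) (x : M), (∀ a ∈ mulE ρ (idealJ ρ) i, a • x ∈ N') →
      idem ρ i • x ∈ N') : saturation N ≤ N' := by
  rintro x ⟨n, hn⟩
  revert x hn
  induction n with
  | zero =>
    intro x hn
    have := hn 1 (by rw [Submodule.pow_zero, Ideal.one_eq_top]; trivial)
    rw [one_smul] at this
    exact hN this
  | succ n ih =>
    intro x hn
    refine mem_of_idem_smul_mem hM fun i => h i x fun a ha => ih fun b hb => ?_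
    rw [← mul_smul]
    refine hn _ ?_
    rw [Submodule.pow_succ]
    exact Ideal.mul_mem_mul hb (mulE_le ρ _ i ha)

end Saturation

/-! ### Torsion-closed modules: extension property, direct sums, retracts -/

section Closed

variable {V : Type u} [Quiver.{u} V] {R : Type u} [CommRing R] (ρ : Set (PathAlgebra R V))

/-- A module is torsion-closed if it is torsion-free and every homomorphism from a left ideal
`J e_i` to it is given by an element. -/
def IsTorsionClosed (M : Type u) [AddCommGroup M] [Module (Alg1 ρ) M] : Prop :=
  torsionRadical ρ M = ⊥ ∧
    ∀ (i : V) (φ : mulE ρ (idealJ ρ) i →ₗ[Alg1 ρ] M), ∃ m : M, ∀ a, φ a = (a : Alg1 ρ) • m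

variable {ρ}

lemma eq_zero_of_torsionRadical_eq_bot {M : Type u} [AddCommGroup M] [Module (Alg1 ρ) M]
    (h : torsionRadical ρ M = ⊥) {x : M} (n : ℕ) (hx : ∀ a ∈ idealJ ρ ^ n, a • x = 0) : x = 0 := by
  have : x ∈ torsionRadical ρ M := ⟨n, hx⟩
  rwa [h, Submodule.mem_bot] at this

lemma idem_smul_eq_zero {M : Type u} [AddCommGroup M] [Module (Alg1 ρ) M]
    (h : torsionRadical ρ M = ⊥) {x : M} {i : V} (hx : ∀ a ∈ mulE ρ (idealJ ρ) i, a • x = 0) :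
    idem ρ i • x = 0 := by
  refine eq_zero_of_torsionRadical_eq_bot h 1 fun a ha => ?_
  rw [Submodule.pow_one] at ha
  rw [← mul_smul]
  exact hx _ (mul_idem_mem_mulE ρ ha i)

lemma unitaryPart_prod {X Y : Type u} [AddCommGroup X] [Module (Alg1 ρ) X] [AddCommGroup Y]
    [Module (Alg1 ρ) Y] (hX : unitaryPart ρ X = ⊤) (hY : unitaryPart ρ Y = ⊤) :
    unitaryPart ρ (X × Y) = ⊤ := by
  classical
  refine eq_top_iff.2 fun z _ => ?_
  obtain ⟨s, hs⟩ : z.1 ∈ unitaryPart ρ X := hX ▸ Submodule.mem_top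
  obtain ⟨s', hs'⟩ : z.2 ∈ unitaryPart ρ Y := hY ▸ Submodule.mem_top
  exact ⟨s ∪ s', fun t ht => Prod.ext (hs t (Finset.union_subset_left ht))
    (hs' t (Finset.union_subset_right ht))⟩

/-- Homomorphisms to a torsion-closed module extend along homomorphisms with torsion cokernel, if
they vanish on the kernel. -/
theorem IsTorsionClosed.exists_extension (hfin : IsLocallyFiniteQuiver V)
    {X Y M : Type u} [AddCommGroup X] [Module (Alg1 ρ) X] [AddCommGroup Y] [Module (Alg1 ρ) Y]
    [AddCommGroup M] [Module (Alg1 ρ) M] (hY : unitaryPart ρ Y = ⊤) (hMu : unitaryPart ρ M = ⊤)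
    (hM : IsTorsionClosed ρ M) (f : X →ₗ[Alg1 ρ] Y) (g : X →ₗ[Alg1 ρ] M)
    (hker : ∀ x, f x = 0 → g x = 0) (hsat : saturation (LinearMap.range f) = ⊤) :
    ∃ h : Y →ₗ[Alg1 ρ] M, ∀ x, h (f x) = g x := by
  -- The extension is built as a graph: the saturation of the relation f x ↦ g x. Torsion-freeness
  -- of M makes it single-valued, and the extension property makes it defined on all of Y.
  let G₀ : Submodule (Alg1 ρ) (Y × M) := LinearMap.range (f.prod g)
  let G := saturation G₀
  have hG : ∀ z ∈ G, z.1 = 0 → z.2 = 0 := by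
    rintro ⟨y, m⟩ ⟨n, hn⟩ (rfl : y = 0)
    refine eq_zero_of_torsionRadical_eq_bot hM.1 n fun a ha => ?_
    obtain ⟨x, hx⟩ := hn a ha
    have h1 : f x = a • (0 : Y) := congrArg Prod.fst hx
    have h2 : g x = a • m := congrArg Prod.snd hx
    rw [← h2, hker x (h1.trans (smul_zero a))]
  have hfun : ∀ y m m', (y, m) ∈ G → (y, m') ∈ G → m = m' := fun y m m' h h' => by
    have := hG _ (G.sub_mem h h') (by simp)
    exact sub_eq_zero.1 this
  let D := G.map (LinearMap.fst (Alg1 ρ) Y M)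
  let h : D →ₗ[Alg1 ρ] M := G.toLinearPMap.toFun
  have hh : ∀ y : D, (y.1, h y) ∈ G := fun y => Submodule.mem_graph_toLinearPMap hG y
  have hfD : LinearMap.range f ≤ D := by
    rintro _ ⟨x, rfl⟩
    exact ⟨(f x, g x), le_saturation G₀ ⟨x, rfl⟩, rfl⟩
  have hD : D = ⊤ := by
    rw [eq_top_iff, ← hsat]
    refine saturation_le_of_forall hY hfD fun i y hy => ?_
    -- If J e_i y lies in the domain, then a ↦ h (a y) is given by an element m. The pair (e_i y,
    -- e_i m) is carried into G by J, hence lies in the saturated G.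
    let φ : mulE ρ (idealJ ρ) i →ₗ[Alg1 ρ] M :=
      h ∘ₗ ((LinearMap.toSpanSingleton (Alg1 ρ) Y y).domRestrict _).codRestrict D
        fun a => hy a.1 a.2
    obtain ⟨m, hm⟩ := hM.2 i φ
    refine ⟨(idem ρ i • y, idem ρ i • m), ?_, rfl⟩
    refine saturation_saturation hfin (unitaryPart_prod hY hMu) G₀ ⟨1, fun a ha => ?_⟩
    rw [Submodule.pow_one] at ha
    have ha' := mul_idem_mem_mulE ρ ha i
    have : (((a * idem ρ i) • y, (a * idem ρ i) • m) : Y × M) ∈ G := by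
      have h1 := hh ⟨(a * idem ρ i) • y, hy _ ha'⟩
      have h2 : h ⟨(a * idem ρ i) • y, hy _ ha'⟩ = (a * idem ρ i) • m := hm ⟨_, ha'⟩
      rwa [h2] at h1
    simp only [mul_smul] at this
    exact this
  refine ⟨h ∘ₗ LinearMap.codRestrict D LinearMap.id fun y => hD ▸ Submodule.mem_top, fun x => ?_⟩
  exact hfun _ _ _ (hh _) (le_saturation G₀ ⟨x, rfl⟩)

/-- Each y is carried into the range of f by some J^n, so g y - g' y is a torsion element of a
torsion-free module. -/
lemma eq_of_comp_eq {X Y M : Type u} [AddCommGroup X] [Module (Alg1 ρ) X] [AddCommGroup Y]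
    [Module (Alg1 ρ) Y] [AddCommGroup M] [Module (Alg1 ρ) M] (hM : torsionRadical ρ M = ⊥)
    (f : X →ₗ[Alg1 ρ] Y) (hsat : saturation (LinearMap.range f) = ⊤) {g g' : Y →ₗ[Alg1 ρ] M}
    (h : ∀ x, g (f x) = g' (f x)) : g = g' := by
  ext y
  obtain ⟨n, hn⟩ : y ∈ saturation (LinearMap.range f) := hsat ▸ Submodule.mem_top
  refine sub_eq_zero.1 (eq_zero_of_torsionRadical_eq_bot hM n fun a ha => ?_)
  obtain ⟨x, hx⟩ := hn a ha
  rw [smul_sub, ← map_smul, ← map_smul, ← hx, h, sub_self]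

open DirectSum in
lemma unitaryPart_directSum {ι : Type u} (N : ι → Type u) [∀ k, AddCommGroup (N k)]
    [∀ k, Module (Alg1 ρ) (N k)] (h : ∀ k, unitaryPart ρ (N k) = ⊤) :
    unitaryPart ρ (⨁ k, N k) = ⊤ := by
  classical
  refine eq_top_iff.2 fun z _ => ?_
  induction z using DirectSum.induction_on with
  | zero => exact Submodule.zero_mem _
  | of k x =>
    obtain ⟨s, hs⟩ : x ∈ unitaryPart ρ (N k) := h k ▸ Submodule.mem_top
    refine ⟨s, fun t ht => ?_⟩
    change _ • DirectSum.lof (Alg1 ρ) ι N k x = DirectSum.lof (Alg1 ρ) ι N k x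
    rw [← map_smul, hs t ht]
  | add x y hx hy => exact Submodule.add_mem _ (hx trivial) (hy trivial)

open DirectSum in
/-- Direct sums of torsion-closed modules are torsion-closed. -/
theorem IsTorsionClosed.directSum (hfin : IsLocallyFiniteQuiver V) {ι : Type u} (N : ι → Type u)
    [∀ k, AddCommGroup (N k)] [∀ k, Module (Alg1 ρ) (N k)] (h : ∀ k, IsTorsionClosed ρ (N k)) :
    IsTorsionClosed ρ (⨁ k, N k) := by
  classical
  constructor
  · refine (Submodule.eq_bot_iff _).2 ?_
    rintro x ⟨n, hn⟩
    refine DFinsupp.ext fun k => eq_zero_of_torsionRadical_eq_bot (h k).1 n fun a ha => ?_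
    exact congrArg (fun z : ⨁ k, N k => z k) (hn a ha)
  · intro i φ
    let φk (k : ι) : mulE ρ (idealJ ρ) i →ₗ[Alg1 ρ] N k := DirectSum.component (Alg1 ρ) ι N k ∘ₗ φ
    choose m hm using fun k => (h k).2 i (φk k)
    have hm' (k : ι) (a : mulE ρ (idealJ ρ) i) : (φ a) k = a.1 • idem ρ i • m k := by
      rw [← mul_smul, mul_idem_of_mem_mulE ρ a.2]
      exact hm k a
    have hfg : Module.Finite (Alg1 ρ) (mulE ρ (idealJ ρ) i) := by
      have := fg_mulE_idealJ_pow ρ hfin 1 i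
      rw [Submodule.pow_one] at this
      exact Module.Finite.iff_fg.2 this
    obtain ⟨s, hs⟩ := hfg.fg_top
    -- The components m k need not have finite support as chosen. On the finitely many generators of
    -- J e_i only the indices in T occur; for every other k, J e_i kills m k, so e_i m k = 0 by
    -- torsion-freeness.
    let T : Finset ι := s.biUnion fun g => DFinsupp.support (φ g)
    have hT : ∀ k ∉ T, idem ρ i • m k = 0 := fun k hk => by
      refine idem_smul_eq_zero (h k).1 fun a ha => ?_
      have h0 : φk k = 0 := by
        refine LinearMap.ext_on_range (v := fun g : s => g.1) (by simpa using hs) fun g => ?_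
        by_contra hg
        exact hk (Finset.mem_biUnion.2 ⟨g.1, g.2, DFinsupp.mem_support_iff.2 hg⟩)
      have := hm k ⟨a, ha⟩
      rw [h0] at this
      exact this.symm
    refine ⟨DFinsupp.mk T fun k => idem ρ i • m k, fun a => DFinsupp.ext fun k => ?_⟩
    rw [hm', DFinsupp.smul_apply, DFinsupp.mk_apply]
    split_ifs with hk
    · rfl
    · rw [hT k hk]

/-- A torsion-free retract of a module with the extension property for the left ideals `J e_i` is
torsion-closed. -/
lemma IsTorsionClosed.of_retract {E : Type u} [AddCommGroup E] [Module (Alg1 ρ) E]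
    (hE : ∀ (i : V) (φ : mulE ρ (idealJ ρ) i →ₗ[Alg1 ρ] E), ∃ m : E, ∀ a, φ a = (a : Alg1 ρ) • m)
    (F : Submodule (Alg1 ρ) E) (hF : Disjoint F (torsionRadical ρ E)) (π : E →ₗ[Alg1 ρ] E)
    (hπ : ∀ x, π x ∈ F) (hπF : ∀ x ∈ F, π x = x) : IsTorsionClosed ρ F := by
  constructor
  · refine (Submodule.eq_bot_iff _).2 ?_
    rintro x ⟨n, hn⟩
    have : (x : E) ∈ torsionRadical ρ E := ⟨n, fun a ha => congrArg Subtype.val (hn a ha)⟩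
    exact Subtype.ext (Submodule.disjoint_def.1 hF _ x.2 this)
  · intro i φ
    obtain ⟨m, hm⟩ := hE i (F.subtype ∘ₗ φ)
    refine ⟨⟨π m, hπ m⟩, fun a => Subtype.ext ?_⟩
    have := hm a
    rw [LinearMap.comp_apply, Submodule.subtype_apply] at this
    rw [Submodule.coe_smul, ← map_smul, ← this, hπF _ (φ a).2]

/-- In a module with the extension property for its submodules, a torsion-free submodule is
contained in a torsion-free retract. -/
lemma exists_retract {E : Type u} [AddCommGroup E] [Module (Alg1 ρ) E]
    (hE : ∀ (N : Submodule (Alg1 ρ) E) (φ : N →ₗ[Alg1 ρ] E), ∃ ψ : E →ₗ[Alg1 ρ] E,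
      ∀ x : N, ψ x = φ x)
    (X T : Submodule (Alg1 ρ) E) (hX : Disjoint X T) :
    ∃ (F : Submodule (Alg1 ρ) E) (π : E →ₗ[Alg1 ρ] E), X ≤ F ∧ Disjoint F T ∧
      (∀ x, π x ∈ F) ∧ ∀ x ∈ F, π x = x := by
  have zorn (A B : Submodule (Alg1 ρ) E) (hAB : Disjoint A B) :
      ∃ C, A ≤ C ∧ Maximal (fun C => Disjoint C B) C := by
    refine zorn_le_nonempty₀ {C | Disjoint C B} (fun c hc hchain y hy => ?_) A hAB
    refine ⟨sSup c, ?_, fun z hz => le_sSup hz⟩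
    exact (hchain.directedOn.disjoint_sSup_left).2 fun z hz => hc hz
  -- F and T' are made maximal in turn. The projection of F ⊕ T' to F extends to π on E; maximality
  -- of T' forces π⁻¹(T) = T', so the range of π meets T trivially, and maximality of F then forces
  -- the range to be F.
  obtain ⟨F, hXF, hF⟩ := zorn X T hX
  obtain ⟨T', hTT', hT'⟩ := zorn T F hF.prop.symm
  have hdisj : Disjoint F T' := hT'.prop.symm
  obtain ⟨p, hpF, hpT⟩ : ∃ p : (F ⊔ T' : Submodule (Alg1 ρ) E) →ₗ[Alg1 ρ] E,
      (∀ x (hx : x ∈ F), p ⟨x, le_sup_left (b := T') hx⟩ = x) ∧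
      ∀ x (hx : x ∈ T'), p ⟨x, le_sup_right (a := F) hx⟩ = 0 := by
    let f : E →ₗ.[Alg1 ρ] E := ⟨F, F.subtype⟩
    let g : E →ₗ.[Alg1 ρ] E := ⟨T', 0⟩
    have hfg := LinearPMap.sup_h_of_disjoint f g hdisj
    refine ⟨(f.sup g hfg).toFun, fun x hx => ?_, fun x hx => ?_⟩
    · refine (LinearPMap.sup_apply hfg ⟨x, hx⟩ 0 ⟨x, _⟩ (by simp)).trans ?_
      exact add_zero x
    · refine (LinearPMap.sup_apply hfg 0 ⟨x, hx⟩ ⟨x, _⟩ (by simp)).trans ?_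
      exact add_zero (0 : E)
  obtain ⟨π, hπ⟩ := hE _ p
  have hπF : ∀ x ∈ F, π x = x := fun x hx => (hπ ⟨x, le_sup_left (b := T') hx⟩).trans (hpF x hx)
  have hπT : ∀ x ∈ T', π x = 0 := fun x hx => (hπ ⟨x, le_sup_right (a := F) hx⟩).trans (hpT x hx)
  have hY : T.comap π = T' := by
    refine (hT'.eq_of_le ?_ fun x hx => ?_).symm
    · refine Submodule.disjoint_def.2 fun x hx hxF => ?_
      rw [Submodule.mem_comap, hπF x hxF] at hx
      exact Submodule.disjoint_def.1 hF.prop x hxF hx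
    · rw [Submodule.mem_comap, hπT x hx]
      exact T.zero_mem
  have hrange : LinearMap.range π = F := by
    refine (hF.eq_of_le ?_ fun x hx => LinearMap.mem_range.2 ⟨x, hπF x hx⟩).symm
    refine Submodule.disjoint_def.2 ?_
    rintro _ ⟨x, rfl⟩ hx
    have : x ∈ T.comap π := hx
    rw [hY] at this
    exact hπT x this
  exact ⟨F, π, hXF, hF.prop, fun x => hrange.le (LinearMap.mem_range_self π x), hπF⟩

end Closed

/-! ### Finite presentation of A e_i, J e_i and A e_i / J^n e_i -/

section Presentation

variable {V : Type u} [Quiver.{u} V] {R : Type u} [CommRing R] (ρ : Set (PathAlgebra R V))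

/-- Right multiplication by e_i retracts A¹ onto A e_i, so A e_i is finitely generated projective.
-/
instance finitePresentation_mulE_idealA (i : V) :
    Module.FinitePresentation (Alg1 ρ) (mulE ρ (idealA ρ) i) := by
  let p : Alg1 ρ →ₗ[Alg1 ρ] mulE ρ (idealA ρ) i :=
    (LinearMap.toSpanSingleton (Alg1 ρ) (Alg1 ρ) (idem ρ i)).codRestrict _ fun x =>
      (mem_mulE_idealA ρ).2 (by
        rw [LinearMap.toSpanSingleton_apply, smul_eq_mul, mul_assoc, idem_mul_idem])
  have hp : p ∘ₗ (mulE ρ (idealA ρ) i).subtype = LinearMap.id :=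
    LinearMap.ext fun x => Subtype.ext (mul_idem_of_mem_mulE ρ x.2)
  have := Module.Projective.of_split _ _ hp
  have := Module.Finite.iff_fg.2 (fg_mulE_idealA ρ i)
  exact Module.finitePresentation_of_projective _ _

open Classical in
/-- The contribution of a path to the arrow-coefficients: a path `q a` ending with an arrow `a` into
`i` is sent to `q` in the component of `a`. -/
noncomputable def lastArrow (i : V) : TotalPath V → (Quiver.Costar i →₀ Alg1 ρ)
  | ⟨_, _, .nil⟩ => 0
  | ⟨_, l, .cons (b := j) q a⟩ =>
    if h : l = i then Finsupp.single ⟨j, h ▸ a⟩ (pathElt ρ q) else 0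

/-- The arrow-coefficients of an element of `RQ`. -/
noncomputable def lastArrowLin (i : V) : PathAlgebra R V →ₗ[R] (Quiver.Costar i →₀ Alg1 ρ) :=
  (Finsupp.lift (Quiver.Costar i →₀ Alg1 ρ) R (TotalPath V) (lastArrow ρ i)).comp
    (coeffs R).toLinearMap

variable {ρ} in
lemma lastArrowLin_ofPath (i : V) (p : TotalPath V) :
    lastArrowLin ρ i (ofPath R p) = lastArrow ρ i p := by
  simp [lastArrowLin, ofPath]

lemma lastArrow_cons {i j k : V} (q : Quiver.Path k j) (a : j ⟶ i) :
    lastArrow ρ i ⟨k, i, q.cons a⟩ = Finsupp.single ⟨j, a⟩ (pathElt ρ q) := by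
  simp [lastArrow]

lemma lastArrow_of_ne {i : V} {p : TotalPath V} (h : p.2.1 ≠ i) : lastArrow ρ i p = 0 := by
  obtain ⟨k, l, _ | ⟨q, a⟩⟩ := p
  · rfl
  · exact dif_neg h

lemma smul_eq_algebraMap_smul {M : Type u} [AddCommGroup M] [Module (Alg1 ρ) M] [Module R M]
    [IsScalarTower R (Alg1 ρ) M] (r : R) (m : M) : r • m = algebraMap R (Alg1 ρ) r • m :=
  (algebraMap_smul _ r m).symm

/-- Prefixing does not change the last arrow of a path of positive length. For a vertex x this
fails, since the last arrow of y x then comes from y. -/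
lemma lastArrowLin_mul (i : V) (y : PathAlgebra R V) {x : PathAlgebra R V} (hx : x ∈ pathsGE R 1) :
    lastArrowLin ρ i (y * x) = img ρ y • lastArrowLin ρ i x := by
  refine pathsGE_induction
    (P := fun x => lastArrowLin ρ i (y * x) = img ρ y • lastArrowLin ρ i x) hx
    (by simp) (fun x x' h h' => by rw [mul_add, map_add, map_add, smul_add, h, h'])
    (fun r p hp => ?_)
  refine PathAlgebra.induction (P := fun y => lastArrowLin ρ i (y * r • ofPath R p) =
    img ρ y • lastArrowLin ρ i (r • ofPath R p)) y
    (by rw [zero_mul, img_zero, map_zero, zero_smul])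
    (fun y y' h h' => by rw [add_mul, map_add, img_add, add_smul, h, h']) (fun s q => ?_)
  rw [QuiverRel.mul_smul', QuiverRel.smul_mul, map_smul, map_smul, map_smul, img_smul,
    smul_comm (_ • img ρ _) r, smul_assoc s (img ρ _)]
  congr 2
  obtain ⟨k, l, p⟩ := p
  obtain ⟨k', l', q⟩ := q
  cases p with
  | nil => simp [len] at hp
  | @cons j _ p a =>
    by_cases hl : l = i
    · subst hl
      rw [lastArrowLin_ofPath, lastArrow_cons, Finsupp.smul_single]
      by_cases h : l' = k
      · subst h
        rw [ofPath_mul_ofPath_of_eq, Quiver.Path.comp_cons, lastArrowLin_ofPath, lastArrow_cons,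
          ← pathElt_mul_pathElt]
        rfl
      · rw [ofPath_mul_ofPath_of_ne R (p := ⟨k', l', q⟩) (q := ⟨k, l, p.cons a⟩) h, map_zero,
          smul_eq_mul, show img ρ (ofPath R ⟨k', l', q⟩) = pathElt ρ q from rfl,
          pathElt_mul_pathElt_of_ne ρ h, Finsupp.single_zero]
    · rw [lastArrowLin_ofPath, lastArrow_of_ne ρ (p := ⟨k, l, p.cons a⟩) hl, smul_zero]
      by_cases h : l' = k
      · subst h
        rw [ofPath_mul_ofPath_of_eq, lastArrowLin_ofPath]
        exact lastArrow_of_ne ρ (p := ⟨k', l, _⟩) hl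
      · rw [ofPath_mul_ofPath_of_ne R (p := ⟨k', l', q⟩) (q := ⟨k, l, p.cons a⟩) h, map_zero]

/-- Multiplication by an arrow into `i` on the right. -/
lemma lastArrowLin_mul_arrow {i j : V} (a : j ⟶ i) (x : PathAlgebra R V) :
    lastArrowLin ρ i (x * ofPath R ⟨j, i, a.toPath⟩) =
      Finsupp.single ⟨j, a⟩ (img ρ x * idem ρ j) := by
  rw [lastArrowLin_mul ρ i x (ofPath_mem_pathsGE R (p := ⟨j, i, a.toPath⟩) (by simp [len])),
    lastArrowLin_ofPath]
  have : lastArrow ρ i ⟨j, i, a.toPath⟩ = _ := lastArrow_cons ρ .nil a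
  rw [this, Finsupp.smul_single, smul_eq_mul, idem_eq_pathElt]

/-- The relations with terminus `i`, written in terms of the arrows into `i`. -/
noncomputable def relSpan (i : V) : Submodule (Alg1 ρ) (Quiver.Costar i →₀ Alg1 ρ) :=
  Submodule.span (Alg1 ρ) (lastArrowLin ρ i '' {r ∈ ρ | r * vertex R i = r})

lemma mul_mem_pathsGE_left {n : ℕ} (y : PathAlgebra R V) {x : PathAlgebra R V}
    (hx : x ∈ pathsGE R n) : y * x ∈ pathsGE R n := by
  refine pathsGE_induction (P := fun x => y * x ∈ pathsGE R n) hx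
    (by rw [mul_zero]; exact Submodule.zero_mem _)
    (fun x x' h h' => by rw [mul_add]; exact Submodule.add_mem _ h h') (fun a p hp => ?_)
  refine PathAlgebra.induction (P := fun y => y * a • ofPath R p ∈ pathsGE R n) y
    (by rw [zero_mul]; exact Submodule.zero_mem _)
    (fun x x' h h' => by rw [add_mul]; exact Submodule.add_mem _ h h') (fun b q => ?_)
  rw [QuiverRel.mul_smul', QuiverRel.smul_mul]
  refine Submodule.smul_mem _ _ (Submodule.smul_mem _ _ ?_)
  obtain ⟨i, j, p⟩ := p
  obtain ⟨j', k, q⟩ := q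
  by_cases h : k = i
  · subst h
    rw [ofPath_mul_ofPath_of_eq]
    refine ofPath_mem_pathsGE R (le_trans hp ?_)
    simp [len, Quiver.Path.length_comp]
  · rw [ofPath_mul_ofPath_of_ne R (p := ⟨j', k, q⟩) (q := ⟨i, j, p⟩) h]
    exact Submodule.zero_mem _

lemma lastArrowLin_mul_vertex (i : V) (x : PathAlgebra R V) :
    lastArrowLin ρ i (x * vertex R i) = lastArrowLin ρ i x := by
  refine PathAlgebra.induction (P := fun x => lastArrowLin ρ i (x * vertex R i) =
    lastArrowLin ρ i x) x (by rw [zero_mul])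
    (fun x y hx hy => by rw [add_mul, map_add, map_add, hx, hy]) (fun r p => ?_)
  rw [QuiverRel.smul_mul, map_smul, map_smul]
  congr 1
  obtain ⟨k, l, p⟩ := p
  by_cases h : l = i
  · subst h
    rw [vertex, ofPath_mul_ofPath_of_eq, Quiver.Path.comp_nil]
  · rw [vertex, ofPath_mul_ofPath_of_ne R (p := ⟨k, l, p⟩) (q := ⟨i, i, .nil⟩) h, map_zero,
      lastArrowLin_ofPath, lastArrow_of_ne ρ (p := ⟨k, l, p⟩) h]

lemma lastArrowLin_mul_ofPath_of_ne {i : V} (x : PathAlgebra R V) {p : TotalPath V}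
    (h : p.2.1 ≠ i) : lastArrowLin ρ i (x * ofPath R p) = 0 := by
  refine PathAlgebra.induction (P := fun x => lastArrowLin ρ i (x * ofPath R p) = 0) x
    (by rw [zero_mul, map_zero])
    (fun x y hx hy => by rw [add_mul, map_add, hx, hy, add_zero]) (fun r q => ?_)
  rw [QuiverRel.smul_mul, map_smul]
  obtain ⟨k, l, p⟩ := p
  obtain ⟨k', l', q⟩ := q
  by_cases h' : l' = k
  · subst h'
    rw [ofPath_mul_ofPath_of_eq, lastArrowLin_ofPath,
      lastArrow_of_ne ρ (p := ⟨k', l, q.comp p⟩) h, smul_zero]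
  · rw [ofPath_mul_ofPath_of_ne R (p := ⟨k', l', q⟩) (q := ⟨k, l, p⟩) h', map_zero, smul_zero]

/-- Modulo ⟨ρ⟩, only the relations ending at i leave a trace on last arrows: left multiples are
handled by linearity, while multiplying x on the right by a path that ends in an arrow leaves a
coefficient that already vanishes in A. -/
lemma lastArrowLin_mem_relSpan (hρ : IsAdmissible ρ) (i : V) {x : PathAlgebra R V}
    (hx : x ∈ TwoSidedIdeal.span ρ) : lastArrowLin ρ i x ∈ relSpan ρ i := by
  -- Positive length is carried along because `lastArrowLin_mul` needs it.
  suffices x ∈ pathsGE R 1 ∧ lastArrowLin ρ i x ∈ relSpan ρ i from this.2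
  refine TwoSidedIdeal.span_induction
    (p := fun x _ => x ∈ pathsGE R 1 ∧ lastArrowLin ρ i x ∈ relSpan ρ i)
    ?_ ?_ ?_ ?_ ?_ ?_ hx
  · intro r hr
    obtain ⟨⟨k, l, hkl⟩, hr2⟩ := hρ r hr
    refine ⟨pathsGE_induction (P := fun x => x ∈ pathsGE R 1) hr2 (Submodule.zero_mem _)
      (fun _ _ => Submodule.add_mem _) (fun a p hp => Submodule.smul_mem _ a
        (ofPath_mem_pathsGE R (le_trans one_le_two hp))), ?_⟩
    by_cases h : l = i
    · subst h
      refine Submodule.subset_span ⟨r, ⟨hr, ?_⟩, rfl⟩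
      rw [← hkl, mul_assoc, vertex, vertex, ofPath_mul_ofPath_of_eq, Quiver.Path.comp_nil]
    · rw [← hkl, vertex, vertex, lastArrowLin_mul_ofPath_of_ne ρ _ h]
      exact Submodule.zero_mem _
  · rw [map_zero]
    exact ⟨Submodule.zero_mem _, Submodule.zero_mem _⟩
  · intro x y _ _ hx hy
    rw [map_add]
    exact ⟨Submodule.add_mem _ hx.1 hy.1, Submodule.add_mem _ hx.2 hy.2⟩
  · intro x _ hx
    rw [map_neg]
    exact ⟨Submodule.neg_mem _ hx.1, Submodule.neg_mem _ hx.2⟩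
  · intro y x _ hx
    rw [lastArrowLin_mul ρ i y hx.1]
    exact ⟨mul_mem_pathsGE_left y hx.1, Submodule.smul_mem _ _ hx.2⟩
  · intro y x hxs hx
    refine ⟨mul_mem_pathsGE R hx.1 y, ?_⟩
    refine PathAlgebra.induction (P := fun y => lastArrowLin ρ i (x * y) ∈ relSpan ρ i) y
      (by rw [mul_zero, map_zero]; exact Submodule.zero_mem _)
      (fun y z hy hz => by rw [mul_add, map_add]; exact Submodule.add_mem _ hy hz)
      (fun r p => ?_)
    rw [QuiverRel.mul_smul', map_smul, smul_eq_algebraMap_smul ρ r]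
    refine Submodule.smul_mem _ _ ?_
    obtain ⟨k, l, p⟩ := p
    by_cases h : l = i
    · subst h
      cases p with
      | nil =>
        change lastArrowLin ρ _ (x * vertex R _) ∈ _
        rw [lastArrowLin_mul_vertex]
        exact hx.2
      | @cons j _ p a =>
        have : ofPath R ⟨k, l, p.cons a⟩ = ofPath R ⟨k, j, p⟩ * ofPath R ⟨j, l, a.toPath⟩ :=
          (ofPath_mul_ofPath_of_eq R p a.toPath).symm
        rw [this, ← mul_assoc, lastArrowLin_mul_arrow, (img_eq_zero_iff ρ _).2
          (TwoSidedIdeal.mul_mem_right _ _ _ hxs), zero_mul, Finsupp.single_zero]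
        exact Submodule.zero_mem _
    · rw [lastArrowLin_mul_ofPath_of_ne ρ x (p := ⟨k, l, p⟩) h]
      exact Submodule.zero_mem _

/-- The presentation of `J e_i` by the arrows with terminus `i`. -/
noncomputable def arrowsLin (i : V) : (Quiver.Costar i →₀ Alg1 ρ) →ₗ[Alg1 ρ] Alg1 ρ :=
  Finsupp.linearCombination (Alg1 ρ) fun a => pathElt ρ a.2.toPath

lemma range_arrowsLin (i : V) : LinearMap.range (arrowsLin ρ i) = mulE ρ (idealJ ρ) i := by
  rw [arrowsLin, Finsupp.range_linearCombination, mulE_idealJ_eq_span]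

lemma arrowsLin_lastArrowLin (i : V) {x : PathAlgebra R V} (hx : x ∈ pathsGE R 1) :
    arrowsLin ρ i (lastArrowLin ρ i x) = img ρ (x * vertex R i) := by
  refine pathsGE_induction
    (P := fun x => arrowsLin ρ i (lastArrowLin ρ i x) = img ρ (x * vertex R i)) hx
    (by rw [zero_mul, img_zero, map_zero, map_zero])
    (fun x y hx hy => by rw [add_mul, map_add, map_add, img_add, hx, hy]) (fun r p hp => ?_)
  rw [QuiverRel.smul_mul, img_smul, map_smul, smul_eq_algebraMap_smul ρ r, map_smul,
    smul_eq_mul, ← Algebra.smul_def, lastArrowLin_ofPath]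
  congr 1
  obtain ⟨k, l, p⟩ := p
  by_cases h : l = i
  · subst h
    cases p with
    | nil => simp [len] at hp
    | cons p a =>
      rw [lastArrow_cons, arrowsLin, Finsupp.linearCombination_single, smul_eq_mul,
        pathElt_mul_pathElt, vertex, ofPath_mul_ofPath_of_eq]
      rfl
  · rw [lastArrow_of_ne ρ (p := ⟨k, l, p⟩) h, map_zero, vertex,
      ofPath_mul_ofPath_of_ne R (p := ⟨k, l, p⟩) (q := ⟨i, i, .nil⟩) h, img_zero]

/-- The free module has summands A¹ instead of A e_j, so besides the relations ending at i the
kernel contains 1 - e_j in the component of each arrow j → i. Both families are finite when ρ e_i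
and the set of arrows into i are. -/
lemma ker_arrowsLin (hρ : IsAdmissible ρ) (hfin : IsLocallyFiniteQuiver V) (i : V) :
    LinearMap.ker (arrowsLin ρ i) = relSpan ρ i ⊔ Submodule.span (Alg1 ρ)
      (Set.range fun a : Quiver.Costar i => Finsupp.single a (1 - idem ρ a.1)) := by
  have := (hfin i).2
  have := Fintype.ofFinite (Quiver.Costar i)
  refine le_antisymm (fun c hc => ?_) (sup_le ?_ ?_)
  · choose y hy using fun a : Quiver.Costar i => exists_img_eq ρ
      (Ideal.mul_mem_left (idealA ρ) (c a) (idem_mem_idealA ρ a.1))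
    -- A syzygy is lifted to the path algebra; its image in A is zero, so x lies in ⟨ρ⟩ and its
    -- last-arrow coefficients lie in the span of the relations.
    let x : PathAlgebra R V := ∑ a, y a * ofPath R ⟨a.1, i, a.2.toPath⟩
    have hδ : lastArrowLin ρ i x = ∑ a, Finsupp.single a (c a * idem ρ a.1) := by
      rw [map_sum]
      refine Finset.sum_congr rfl fun a _ => ?_
      rw [lastArrowLin_mul_arrow, hy, mul_assoc, idem_mul_idem]
    have hx : img ρ x = 0 := by
      rw [← imgLin_apply, map_sum, ← LinearMap.mem_ker.1 hc, arrowsLin,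
        Finsupp.linearCombination_apply, Finsupp.sum_fintype c (fun a r => r • pathElt ρ a.2.toPath)
          fun a => zero_smul _ _]
      refine Finset.sum_congr rfl fun a _ => ?_
      rw [imgLin_apply, img_mul, hy, mul_assoc, smul_eq_mul]
      exact congrArg (c a * ·) (idem_mul_pathElt ρ a.2.toPath)
    have hxρ := lastArrowLin_mem_relSpan ρ hρ i ((img_eq_zero_iff ρ x).1 hx)
    have hsum : c = lastArrowLin ρ i x + ∑ a, c a • Finsupp.single a (1 - idem ρ a.1) := by
      rw [hδ, ← Finset.sum_add_distrib]
      conv_lhs => rw [← Finsupp.univ_sum_single c]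
      refine Finset.sum_congr rfl fun a _ => ?_
      rw [Finsupp.smul_single, ← Finsupp.single_add, smul_eq_mul, mul_sub, mul_one,
        add_sub_cancel]
    rw [hsum]
    exact Submodule.add_mem_sup hxρ (Submodule.sum_mem _ fun a _ =>
      Submodule.smul_mem _ _ (Submodule.subset_span ⟨a, rfl⟩))
  · refine Submodule.span_le.2 ?_
    rintro _ ⟨r, ⟨hr, hri⟩, rfl⟩
    have h1 : r ∈ pathsGE R 1 :=
      pathsGE_induction (P := fun x => x ∈ pathsGE R 1) (hρ r hr).2 (Submodule.zero_mem _)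
        (fun _ _ => Submodule.add_mem _) (fun a p hp => Submodule.smul_mem _ a
          (ofPath_mem_pathsGE R (le_trans one_le_two hp)))
    rw [SetLike.mem_coe, LinearMap.mem_ker, arrowsLin_lastArrowLin ρ i h1, hri]
    exact (img_eq_zero_iff ρ r).2 (TwoSidedIdeal.subset_span hr)
  · refine Submodule.span_le.2 ?_
    rintro _ ⟨a, rfl⟩
    rw [SetLike.mem_coe, LinearMap.mem_ker, arrowsLin, Finsupp.linearCombination_single,
      smul_eq_mul, sub_mul, one_mul, idem_mul_pathElt, sub_self]

theorem finitePresentation_mulE_idealJ (hρ : IsAdmissible ρ) (hρfin : IsLocallyFiniteRel ρ)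
    (hfin : IsLocallyFiniteQuiver V) (i : V) :
    Module.FinitePresentation (Alg1 ρ) (mulE ρ (idealJ ρ) i) := by
  have := (hfin i).2
  rw [← range_arrowsLin]
  refine Module.finitePresentation_of_free_of_surjective (arrowsLin ρ i).rangeRestrict
    (LinearMap.surjective_rangeRestrict _) ?_
  rw [LinearMap.ker_rangeRestrict, ker_arrowsLin ρ hρ hfin]
  exact Submodule.FG.sup (Submodule.fg_span ((hρfin i).image _))
    (Submodule.fg_span (Set.finite_range _))

theorem finitePresentation_quotient (hfin : IsLocallyFiniteQuiver V) (n : ℕ) (i : V) :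
    Module.FinitePresentation (Alg1 ρ)
      (mulE ρ (idealA ρ) i ⧸ (mulE ρ (idealJ ρ ^ n) i).submoduleOf (mulE ρ (idealA ρ) i)) := by
  refine Module.finitePresentation_of_surjective (Submodule.mkQ _)
    (Submodule.mkQ_surjective _) ?_
  rw [Submodule.ker_mkQ]
  have hle : mulE ρ (idealJ ρ ^ n) i ≤ mulE ρ (idealA ρ) i := fun x hx =>
    (mem_mulE_idealA ρ).2 (mul_idem_of_mem_mulE ρ hx)
  refine Submodule.fg_of_fg_map_injective (mulE ρ (idealA ρ) i).subtype
    (Submodule.subtype_injective _) ?_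
  rw [Submodule.submoduleOf, Submodule.map_comap_subtype, inf_eq_right.2 hle]
  exact fg_mulE_idealJ_pow ρ hfin n i

end Presentation

/-! ### The category A-Mod and its torsion subcategory -/

section AMod

variable {V : Type u} [Quiver.{u} V] {R : Type u} [CommRing R] (ρ : Set (PathAlgebra R V))

universe v' u'

lemma unitaryPart_eq_top (X : AMod ρ) : unitaryPart ρ X.obj = ⊤ :=
  (unitary_of_iff ρ X.obj).1 X.property

/-- The unitary module on a given type. -/
noncomputable def AMod.of (M : Type u) [AddCommGroup M] [Module (Alg1 ρ) M]
    (h : unitaryPart ρ M = ⊤) : AMod ρ :=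
  ⟨ModuleCat.of (Alg1 ρ) M, (unitary_of_iff ρ M).2 h⟩

/-- The morphism of unitary modules given by a linear map. -/
noncomputable def AMod.ofHom {ρ : Set (PathAlgebra R V)} {X Y : AMod ρ} (f : X.obj →ₗ[Alg1 ρ] Y.obj) : X ⟶ Y :=
  ObjectProperty.homMk (ModuleCat.ofHom f)

lemma unitaryPart_submodule {M : Type u} [AddCommGroup M] [Module (Alg1 ρ) M]
    (h : unitaryPart ρ M = ⊤) (N : Submodule (Alg1 ρ) M) : unitaryPart ρ N = ⊤ := by
  refine eq_top_iff.2 fun z _ => ?_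
  obtain ⟨s, hs⟩ : z.1 ∈ unitaryPart ρ M := h ▸ Submodule.mem_top
  exact ⟨s, fun t ht => Subtype.ext (hs t ht)⟩

lemma unitaryPart_of_le_idealA {L : Ideal (Alg1 ρ)} (h : L ≤ idealA ρ) : unitaryPart ρ L = ⊤ := by
  refine eq_top_iff.2 fun z _ => ?_
  obtain ⟨a, ha⟩ := (mem_idealA ρ).1 (h z.2)
  obtain ⟨s, hs⟩ := exists_eSum_mul ρ a
  exact ⟨s, fun t ht => Subtype.ext (by rw [Submodule.coe_smul, ← ha, smul_eq_mul, hs t ht])⟩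

lemma unitaryPart_quotient {M : Type u} [AddCommGroup M] [Module (Alg1 ρ) M]
    (h : unitaryPart ρ M = ⊤) (N : Submodule (Alg1 ρ) M) : unitaryPart ρ (M ⧸ N) = ⊤ := by
  refine eq_top_iff.2 fun z _ => ?_
  obtain ⟨z, rfl⟩ := Submodule.Quotient.mk_surjective _ z
  obtain ⟨s, hs⟩ : z ∈ unitaryPart ρ M := h ▸ Submodule.mem_top
  exact ⟨s, fun t ht => congrArg Submodule.Quotient.mk (hs t ht)⟩

/-- Every A¹-module has a largest unitary submodule, so colimits of unitary modules can be formed in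
all A¹-modules. The torsion radical plays the same role for torsion modules below. -/
instance (J : Type u') [Category.{v'} J] : (unitary ρ).IsClosedUnderColimitsOfShape J := by
  refine isClosedUnderColimitsOfShape_of_exists_mono _ (fun X => ?_) J
  refine ⟨ModuleCat.of _ (unitaryPart ρ X), ModuleCat.ofHom (unitaryPart ρ X).subtype,
    (unitary_iff ρ _).2 fun m => ?_, (ModuleCat.mono_iff_injective _).2 Subtype.val_injective,
    fun Y f hY => ⟨ModuleCat.ofHom (f.hom.codRestrict _ fun y => ?_), rfl⟩⟩
  · obtain ⟨s, hs⟩ := m.2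
    exact ⟨s, fun t ht => Subtype.ext (hs t ht)⟩
  · obtain ⟨s, hs⟩ := (unitary_iff ρ Y).1 hY y
    exact ⟨s, fun t ht => by rw [← map_smul, hs t ht]⟩

instance : HasColimitsOfSize.{u, u} (AMod ρ) := ⟨fun _ _ => inferInstance⟩

variable {ρ}

instance : (unitary ρ).ι.PreservesMonomorphisms :=
  (unitary ρ).preservesMonomorphisms_ι_of_isNormalEpiCategory

instance : (unitary ρ).ι.PreservesEpimorphisms :=
  (unitary ρ).preservesEpimorphisms_ι_of_isNormalMonoCategory

lemma AMod.mono_iff {X Y : AMod ρ} (f : X ⟶ Y) : Mono f ↔ Function.Injective f.hom.hom := by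
  rw [← (unitary ρ).ι.mono_map_iff_mono]
  exact ModuleCat.mono_iff_injective _

lemma AMod.epi_iff {X Y : AMod ρ} (f : X ⟶ Y) : Epi f ↔ Function.Surjective f.hom.hom := by
  rw [← (unitary ρ).ι.epi_map_iff_epi]
  exact ModuleCat.epi_iff_surjective _

instance : (unitary ρ).ι.Additive where

instance : (unitary ρ).ι.PreservesHomology :=
  have := (unitary ρ).preservesKernels_ι
  have := (unitary ρ).preservesCokernels_ι
  ⟨inferInstance, inferInstance⟩

lemma AMod.exact_iff (S : ShortComplex (AMod ρ)) :
    S.Exact ↔ ∀ x, S.g.hom.hom x = 0 → ∃ y, S.f.hom.hom y = x := by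
  rw [← S.exact_map_iff_of_faithful (unitary ρ).ι, ShortComplex.moduleCat_exact_iff]
  rfl

lemma AMod.shortExact_of {X Y Z : AMod ρ} (f : X ⟶ Y) (g : Y ⟶ Z) (w : f ≫ g = 0)
    (hf : Function.Injective f.hom.hom) (hg : Function.Surjective g.hom.hom)
    (h : ∀ x, g.hom.hom x = 0 → ∃ y, f.hom.hom y = x) : (ShortComplex.mk f g w).ShortExact where
  exact := (AMod.exact_iff _).2 h
  mono_f := (AMod.mono_iff f).2 hf
  epi_g := (AMod.epi_iff g).2 hg

/-- The kernel of a morphism is torsion if and only if its elements are torsion elements. -/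
lemma torsion_kernel_iff {X Y : AMod ρ} (f : X ⟶ Y) :
    torsion ρ (kernel f) ↔ ∀ x, f.hom.hom x = 0 → x ∈ torsionRadical ρ X.obj := by
  have hex := (AMod.exact_iff _).1 (ShortComplex.exact_kernel f)
  have hinj := (AMod.mono_iff (kernel.ι f)).1 inferInstance
  have hz : ∀ y, f.hom.hom ((kernel.ι f).hom.hom y) = 0 := fun y =>
    congrArg (fun k => k.hom.hom y) (kernel.condition f)
  constructor
  · intro h x hx
    obtain ⟨y, rfl⟩ := hex x hx
    obtain ⟨n, hn⟩ := h y
    refine ⟨n, fun a ha => ?_⟩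
    rw [← map_smul]
    exact (congrArg _ (hn a ha)).trans (map_zero _)
  · intro h y
    obtain ⟨n, hn⟩ := h _ (hz y)
    refine ⟨n, fun a ha => hinj ?_⟩
    rw [map_smul, map_zero]
    exact hn a ha

/-- The cokernel of a morphism is torsion if and only if the saturation of its range is
everything. -/
lemma torsion_cokernel_iff {X Y : AMod ρ} (f : X ⟶ Y) :
    torsion ρ (cokernel f) ↔ saturation (ρ := ρ) (LinearMap.range f.hom.hom) = ⊤ := by
  have hex := (AMod.exact_iff _).1 (ShortComplex.exact_cokernel f)
  have hsurj := (AMod.epi_iff (cokernel.π f)).1 inferInstance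
  have hz : ∀ y, (cokernel.π f).hom.hom (f.hom.hom y) = 0 := fun y =>
    congrArg (fun k => k.hom.hom y) (cokernel.condition f)
  constructor
  · intro h
    refine eq_top_iff.2 fun y _ => ?_
    obtain ⟨n, hn⟩ := h ((cokernel.π f).hom.hom y)
    refine ⟨n, fun a ha => hex _ ?_⟩
    have := hn a ha
    rw [← map_smul] at this
    exact this
  · intro h z
    obtain ⟨y, rfl⟩ := hsurj z
    obtain ⟨n, hn⟩ : y ∈ saturation (ρ := ρ) (LinearMap.range f.hom.hom) := h ▸ Submodule.mem_top
    refine ⟨n, fun a ha => ?_⟩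
    obtain ⟨x, hx⟩ := hn a ha
    rw [← map_smul, ← hx]
    exact hz x

open ZeroObject in
instance : (torsion ρ).ContainsZero where
  exists_zero := ⟨0, isZero_zero _, fun x => by
    have : x = 0 := congrArg (fun k : (0 : AMod ρ) ⟶ 0 => k.hom.hom x)
      ((isZero_zero (AMod ρ)).eq_of_src (𝟙 _) 0)
    rw [this]
    exact Submodule.zero_mem _⟩

instance : (torsion ρ).IsClosedUnderSubobjects where
  prop_of_mono {X Y} f hf hY x := by
    obtain ⟨n, hn⟩ := hY (f.hom.hom x)
    refine ⟨n, fun a ha => (AMod.mono_iff f).1 hf ?_⟩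
    rw [map_smul, map_zero]
    exact hn a ha

instance : (torsion ρ).IsClosedUnderQuotients where
  prop_of_epi {X Y} f hf hX y := by
    obtain ⟨x, rfl⟩ := (AMod.epi_iff f).1 hf y
    obtain ⟨n, hn⟩ := hX x
    refine ⟨n, fun a ha => ?_⟩
    rw [← map_smul, hn a ha, map_zero]

variable (ρ) in
-- Closure under extensions is the idempotence of saturation at ⊥: some J^n carries x into the image
-- of the torsion subobject.
theorem isSerreClass_torsion (hfin : IsLocallyFiniteQuiver V) : (torsion ρ).IsSerreClass where
  prop_X₂_of_shortExact {S} hS h₁ h₃ x := by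
    refine saturation_saturation hfin (unitaryPart_eq_top ρ S.X₂) ⊥ ?_
    obtain ⟨n, hn⟩ := h₃ (S.g.hom.hom x)
    refine ⟨n, fun a ha => ?_⟩
    obtain ⟨y, hy⟩ := (AMod.exact_iff S).1 hS.exact (a • x) (by rw [map_smul]; exact hn a ha)
    obtain ⟨m, hm⟩ := h₁ y
    refine ⟨m, fun b hb => ?_⟩
    rw [← hy, ← map_smul, hm b hb, map_zero]
    exact Submodule.zero_mem _

instance (J : Type u') [Category.{v'} J] : (torsion ρ).IsClosedUnderColimitsOfShape J := by
  refine isClosedUnderColimitsOfShape_of_exists_mono _ (fun X => ?_) J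
  refine ⟨AMod.of ρ _ (unitaryPart_submodule ρ (unitaryPart_eq_top ρ X)
    (torsionRadical ρ X.obj)), AMod.ofHom (Submodule.subtype _), fun x => ?_,
    (AMod.mono_iff _).2 Subtype.val_injective,
    fun Y f hY => ⟨AMod.ofHom (f.hom.hom.codRestrict _ fun y => ?_), rfl⟩⟩
  · obtain ⟨n, hn⟩ := x.2
    exact ⟨n, fun a ha => Subtype.ext (hn a ha)⟩
  · obtain ⟨n, hn⟩ := hY y
    exact ⟨n, fun a ha => by rw [← map_smul, hn a ha, map_zero]⟩

instance : HasColimitsOfSize.{u, u} (torsion ρ).FullSubcategory := ⟨fun _ _ => inferInstance⟩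

instance : (torsion ρ).IsClosedUnderFiniteProducts :=
  have : HasFiniteBiproducts (AMod ρ) := Abelian.hasFiniteBiproducts
  ⟨fun J _ => ⟨by
    rintro X ⟨p⟩
    let f : J → AMod ρ := fun j => p.diag.obj ⟨j⟩
    have e : p.diag ≅ Discrete.functor f := Discrete.natIsoFunctor
    let e' : X ≅ ⨁ f := (p.isLimit.conePointsIsoOfNatIso (biproduct.isLimit f) e)
    refine (torsion ρ).prop_of_iso e'.symm ?_
    exact (torsion ρ).prop_of_isColimit (biproduct.isColimit f) fun j => p.prop_diag_obj j⟩⟩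

noncomputable instance : Abelian (torsion ρ).FullSubcategory := inferInstance

/-- The projective module `A e_i`. -/
noncomputable def moduleAe (ρ : Set (PathAlgebra R V)) (i : V) : AMod ρ :=
  AMod.of ρ (mulE ρ (idealA ρ) i) (unitaryPart_of_le_idealA ρ (mulE_idealA_le ρ i))

/-- The left ideal `J e_i` as an object of `A-Mod`. -/
noncomputable def moduleJe (ρ : Set (PathAlgebra R V)) (i : V) : AMod ρ :=
  AMod.of ρ (mulE ρ (idealJ ρ) i) (unitaryPart_of_le_idealA ρ
    ((mulE_mono ρ (idealJ_le_idealA ρ) i).trans (mulE_idealA_le ρ i)))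

/-- The quotient `A e_i / J^n e_i`. -/
noncomputable def moduleAeModPow (ρ : Set (PathAlgebra R V)) (n : ℕ) (i : V) : AMod ρ :=
  AMod.quot ρ (mulE ρ (idealA ρ) i) (mulE ρ (idealJ ρ ^ n) i) (mulE_idealA_le ρ i)

attribute [local instance] Cardinal.fact_isRegular_aleph0

lemma isFinitelyPresentable_of_finitePresentation_obj (X : AMod ρ)
    (h : Module.FinitePresentation (Alg1 ρ) X.obj) : IsFinitelyPresentable.{u} X :=
  have := isFinitelyPresentable_of_finitePresentation X.obj
  isFinitelyPresentable_fullSubcategory _ X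

lemma isFinitelyPresentable_moduleAe (i : V) : IsFinitelyPresentable.{u} (moduleAe ρ i) :=
  isFinitelyPresentable_of_finitePresentation_obj _ (finitePresentation_mulE_idealA ρ i)

lemma isFinitelyPresentable_moduleJe (hρ : IsAdmissible ρ) (hρfin : IsLocallyFiniteRel ρ)
    (hfin : IsLocallyFiniteQuiver V) (i : V) : IsFinitelyPresentable.{u} (moduleJe ρ i) :=
  isFinitelyPresentable_of_finitePresentation_obj _
    (finitePresentation_mulE_idealJ ρ hρ hρfin hfin i)

lemma isFinitelyPresentable_moduleAeModPow (hfin : IsLocallyFiniteQuiver V) (n : ℕ) (i : V) :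
    IsFinitelyPresentable.{u} (moduleAeModPow ρ n i) :=
  isFinitelyPresentable_of_finitePresentation_obj _ (finitePresentation_quotient ρ hfin n i)

/-- The morphism `A e_i → X` given by an element. -/
noncomputable def AMod.ofElt {X : AMod ρ} (i : V) (x : X.obj) : moduleAe ρ i ⟶ X :=
  AMod.ofHom ((LinearMap.toSpanSingleton (Alg1 ρ) X.obj x).domRestrict (mulE ρ (idealA ρ) i))

/-- The morphism `A e_i / J^n e_i → X` given by an element annihilated by `J^n`. -/
noncomputable def AMod.ofTorsionElt {X : AMod ρ} (n : ℕ) (i : V) (x : X.obj)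
    (h : ∀ a ∈ idealJ ρ ^ n, a • x = 0) : moduleAeModPow ρ n i ⟶ X :=
  AMod.ofHom (Submodule.liftQ _
    ((LinearMap.toSpanSingleton (Alg1 ρ) X.obj x).domRestrict (mulE ρ (idealA ρ) i))
    fun _ ha => h _ (mulE_le ρ _ i ha))

lemma AMod.ext_of_idem {X Y : AMod ρ} {f g : X ⟶ Y}
    (h : ∀ i x, f.hom.hom (idem ρ i • x) = g.hom.hom (idem ρ i • x)) : f = g := by
  refine ObjectProperty.hom_ext _ (ModuleCat.hom_ext (LinearMap.ext fun x => ?_))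
  exact LinearMap.mem_eqLocus.1 (mem_of_idem_smul_mem (unitaryPart_eq_top ρ X)
    (N := LinearMap.eqLocus f.hom.hom g.hom.hom) fun i => h i x)

/-- The modules A e_i separate, because a morphism is determined by its values at the elements e_i
x. -/
theorem isLocallyFinitelyPresentable_AMod : IsLocallyFinitelyPresentable.{u} (AMod ρ) := by
  refine isLocallyFinitelyPresentable_of_isSeparating (.ofObj (moduleAe ρ)) (fun X Y f g h => ?_) ?_
  · refine AMod.ext_of_idem fun i x => ?_
    have := h _ ⟨i⟩ (AMod.ofElt i x)
    exact congrArg (fun k => k.hom.hom (⟨_, idem_mem_mulE_idealA ρ i⟩ : mulE ρ (idealA ρ) i)) this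
  · rintro _ ⟨i⟩
    exact isFinitelyPresentable_moduleAe i

end AMod

/-! ### Truncation by path length and homogeneous relations -/

section Truncation

variable {V : Type u} [Quiver.{u} V] {R : Type u} [CommRing R] (ρ : Set (PathAlgebra R V))

variable (R) in
/-- The truncation of an element of `RQ`: the part that consists of the paths of length `< m`. -/
noncomputable def trunc (m : ℕ) : PathAlgebra R V →ₗ[R] PathAlgebra R V :=
  (Finsupp.lift (PathAlgebra R V) R (TotalPath V) fun p =>
    if len p < m then ofPath R p else 0).comp (coeffs R).toLinearMap

lemma trunc_ofPath (m : ℕ) (p : TotalPath V) :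
    trunc R m (ofPath R p) = if len p < m then ofPath R p else 0 := by
  simp [trunc, ofPath]

lemma trunc_eq_zero {m : ℕ} {x : PathAlgebra R V} (hx : x ∈ pathsGE R m) : trunc R m x = 0 := by
  refine pathsGE_induction (P := fun x => trunc R m x = 0) hx (map_zero _)
    (fun x y hx hy => by rw [map_add, hx, hy, add_zero]) (fun a p hp => ?_)
  rw [map_smul, trunc_ofPath, if_neg hp.not_gt, smul_zero]

lemma trunc_vertex_mul {m : ℕ} {i : V} (h : ∀ (j : V) (p : Quiver.Path i j), p.length < m)
    (x : PathAlgebra R V) : trunc R m (vertex R i * x) = vertex R i * x := by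
  refine PathAlgebra.induction (P := fun x => trunc R m (vertex R i * x) = vertex R i * x) x
    (by rw [mul_zero, map_zero])
    (fun x y hx hy => by rw [mul_add, map_add, hx, hy]) (fun a p => ?_)
  rw [QuiverRel.mul_smul', map_smul]
  congr 1
  obtain ⟨k, l, p⟩ := p
  by_cases hk : i = k
  · subst hk
    rw [vertex, ofPath_mul_ofPath_of_eq, trunc_ofPath, Quiver.Path.nil_comp]
    exact if_pos (h l p)
  · rw [vertex, ofPath_mul_ofPath_of_ne R (p := ⟨i, i, .nil⟩) (q := ⟨k, l, p⟩) hk, map_zero]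

/-- The subtraction is the truncated one: if q has length at least m, the right side uses truncation
at 0, which is zero, as is the left side. -/
lemma trunc_ofPath_mul (m : ℕ) (q : TotalPath V) (x : PathAlgebra R V) :
    trunc R m (ofPath R q * x) = ofPath R q * trunc R (m - len q) x := by
  refine PathAlgebra.induction
    (P := fun x => trunc R m (ofPath R q * x) = ofPath R q * trunc R (m - len q) x) x
    (by rw [mul_zero, map_zero, map_zero, mul_zero])
    (fun x y hx hy => by rw [mul_add, map_add, map_add, mul_add, hx, hy]) (fun a p => ?_)
  rw [QuiverRel.mul_smul', map_smul, map_smul, QuiverRel.mul_smul']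
  congr 1
  obtain ⟨k, l, p⟩ := p
  obtain ⟨k', l', q⟩ := q
  by_cases h : l' = k
  · subst h
    have hlen : len ⟨k', l, q.comp p⟩ = len ⟨k', l', q⟩ + len ⟨l', l, p⟩ :=
      Quiver.Path.length_comp q p
    rw [ofPath_mul_ofPath_of_eq, trunc_ofPath, trunc_ofPath, hlen]
    split_ifs
    · rw [ofPath_mul_ofPath_of_eq]
    · omega
    · omega
    · rw [mul_zero]
  · have h0 := ofPath_mul_ofPath_of_ne R (p := ⟨k', l', q⟩) (q := ⟨k, l, p⟩) h
    rw [h0, map_zero, trunc_ofPath]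
    split_ifs
    · rw [h0]
    · rw [mul_zero]

lemma trunc_mul_ofPath (m : ℕ) (x : PathAlgebra R V) (q : TotalPath V) :
    trunc R m (x * ofPath R q) = trunc R (m - len q) x * ofPath R q := by
  refine PathAlgebra.induction
    (P := fun x => trunc R m (x * ofPath R q) = trunc R (m - len q) x * ofPath R q) x
    (by rw [zero_mul, map_zero, map_zero, zero_mul])
    (fun x y hx hy => by rw [add_mul, map_add, map_add, add_mul, hx, hy]) (fun a p => ?_)
  rw [QuiverRel.smul_mul, map_smul, map_smul, QuiverRel.smul_mul]
  congr 1
  obtain ⟨k, l, p⟩ := p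
  obtain ⟨k', l', q⟩ := q
  by_cases h : l = k'
  · subst h
    have hlen : len ⟨k, l', p.comp q⟩ = len ⟨k, l, p⟩ + len ⟨l, l', q⟩ :=
      Quiver.Path.length_comp p q
    rw [ofPath_mul_ofPath_of_eq, trunc_ofPath, trunc_ofPath, hlen]
    split_ifs
    · rw [ofPath_mul_ofPath_of_eq]
    · omega
    · omega
    · rw [zero_mul]
  · have h0 := ofPath_mul_ofPath_of_ne R (p := ⟨k, l, p⟩) (q := ⟨k', l', q⟩) h
    rw [h0, map_zero, trunc_ofPath]
    split_ifs
    · rw [h0]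
    · rw [zero_mul]

lemma sum_paths (x : PathAlgebra R V) : x = ∑ p ∈ paths x, coeffs R x p • ofPath R p := by
  apply (coeffs R).injective
  conv_lhs => rw [← Finsupp.sum_single (coeffs R x), Finsupp.sum]
  rw [map_sum]
  refine Finset.sum_congr rfl fun p _ => ?_
  simp [ofPath]

variable {ρ} in
/-- The ideal generated by homogeneous relations is stable under truncation. -/
lemma trunc_mem_span (hhom : IsHomogeneousRel ρ) {x : PathAlgebra R V}
    (hx : x ∈ TwoSidedIdeal.span ρ) (m : ℕ) : trunc R m x ∈ TwoSidedIdeal.span ρ := by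
  -- The cutoff m is quantified inside the induction since multiplying by a path shifts it.
  refine TwoSidedIdeal.span_induction
    (p := fun x _ => ∀ m, trunc R m x ∈ TwoSidedIdeal.span ρ) ?_ ?_ ?_ ?_ ?_ ?_ hx m
  · intro r hr m
    obtain ⟨d, hd⟩ := hhom r hr
    -- Homogeneity: a relation is kept whole or dropped whole.
    have : trunc R m r = if d < m then r else 0 := by
      conv_lhs => rw [sum_paths r, map_sum]
      conv_rhs => rw [sum_paths r]
      rw [Finset.sum_congr rfl fun p hp => by
        rw [map_smul, trunc_ofPath, hd p hp]]
      split_ifs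
      · rfl
      · simp
    rw [this]
    split_ifs
    · exact TwoSidedIdeal.subset_span hr
    · exact zero_mem _
  · intro m
    rw [map_zero]
    exact zero_mem _
  · intro x y _ _ hx hy m
    rw [map_add]
    exact add_mem (hx m) (hy m)
  · intro x _ hx m
    rw [map_neg]
    exact neg_mem (hx m)
  · intro y x _ hx m
    refine PathAlgebra.induction (P := fun y => trunc R m (y * x) ∈ TwoSidedIdeal.span ρ) y
      (by rw [zero_mul, map_zero]; exact zero_mem _)
      (fun y z hy hz => by rw [add_mul, map_add]; exact add_mem hy hz) (fun a p => ?_)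
    rw [QuiverRel.smul_mul, map_smul, trunc_ofPath_mul]
    exact smul_mem_span ρ a (TwoSidedIdeal.mul_mem_left _ _ _ (hx _))
  · intro y x _ hx m
    refine PathAlgebra.induction (P := fun y => trunc R m (x * y) ∈ TwoSidedIdeal.span ρ) y
      (by rw [mul_zero, map_zero]; exact zero_mem _)
      (fun y z hy hz => by rw [mul_add, map_add]; exact add_mem hy hz) (fun a p => ?_)
    rw [QuiverRel.mul_smul', map_smul, trunc_mul_ofPath]
    exact smul_mem_span ρ a (TwoSidedIdeal.mul_mem_right _ _ _ (hx _))

/-- The left ideal `J^n e_i` is generated by the paths of length `n` with terminus `i`. -/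
lemma mulE_idealJ_pow_le_span (n : ℕ) (i : V) : mulE ρ (idealJ ρ ^ n) i ≤
    Ideal.span {x | ∃ (k : V) (p : Quiver.Path k i), p.length = n ∧ pathElt ρ p = x} := by
  induction n generalizing i with
  | zero =>
    rintro _ ⟨x, -, rfl⟩
    exact Ideal.mul_mem_left _ x (Ideal.subset_span ⟨i, .nil, rfl, rfl⟩)
  | succ n ih =>
    rw [mulE_idealJ_pow_succ]
    refine iSup_le fun a => (Submodule.map_mono (ih a.1)).trans ?_
    rw [Ideal.span, Submodule.map_span]
    refine Submodule.span_mono ?_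
    rintro _ ⟨_, ⟨k, p, rfl, rfl⟩, rfl⟩
    exact ⟨k, p.cons a.2, rfl, (pathElt_mul_pathElt ρ p a.2.toPath).symm⟩

lemma exists_img_eq_of_mem_mulE_idealJ_pow {n : ℕ} {i : V} {x : Alg1 ρ}
    (hx : x ∈ mulE ρ (idealJ ρ ^ n) i) : ∃ y ∈ pathsGE R n, img ρ y = x := by
  refine Submodule.span_induction (p := fun x _ => ∃ y ∈ pathsGE R n, img ρ y = x) ?_ ?_ ?_ ?_
    (mulE_idealJ_pow_le_span ρ n i hx)
  · rintro _ ⟨k, p, rfl, rfl⟩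
    exact ⟨_, ofPath_mem_pathsGE R (p := ⟨k, i, p⟩) le_rfl, rfl⟩
  · exact ⟨0, Submodule.zero_mem _, img_zero ρ⟩
  · rintro _ _ _ _ ⟨y, hy, rfl⟩ ⟨z, hz, rfl⟩
    exact ⟨y + z, Submodule.add_mem _ hy hz, img_add ρ y z⟩
  · rintro b _ _ ⟨y, hy, rfl⟩
    obtain ⟨r, c, rfl⟩ : ∃ r c, b = algebraMap R (Alg1 ρ) r + inA ρ c :=
      ⟨b.fst, b.snd, (Unitization.inl_fst_add_inr_snd_eq b).symm⟩
    obtain ⟨z, rfl⟩ := proj_surjective ρ c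
    refine ⟨r • y + z * y, Submodule.add_mem _ (Submodule.smul_mem _ r hy)
      (mul_mem_pathsGE_left z hy), ?_⟩
    rw [img_add, img_smul, img_mul, add_smul, ← smul_eq_algebraMap_smul, smul_eq_mul]
    rfl

/-- With homogeneous relations, an element of `e_i A` of bounded degree that `J^n` moves far up in
the filtration is torsion. -/
lemma eq_zero_of_pow_mul_mem (hhom : IsHomogeneousRel ρ) (ht : torsionA ρ = ⊥) {i j : V} {L : ℕ}
    (hL : ∀ (k : V) (p : Quiver.Path i k), p.length ≤ L) {n m : ℕ} (hm : n + L + 1 ≤ m)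
    {c : Alg1 ρ} (hcA : c ∈ idealA ρ) (hc : idem ρ i * c = c)
    (h : ∀ b ∈ idealJ ρ ^ n, b * c ∈ mulE ρ (idealJ ρ ^ m) j) : c = 0 := by
  obtain ⟨z, rfl⟩ := exists_img_eq ρ hcA
  rw [idem, ← img_mul] at hc
  have hpath : ∀ (k : V) (p : Quiver.Path k i), p.length = n →
      pathElt ρ p * img ρ (vertex R i * z) = 0 := fun k p hp => by
    obtain ⟨y, hy, hyp⟩ := exists_img_eq_of_mem_mulE_idealJ_pow ρ
      (h _ (hp ▸ pathElt_mem_idealJ_pow ρ p))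
    rw [← hc, pathElt, ← img_mul, ← sub_eq_zero, ← imgLin_apply, ← imgLin_apply, ← map_sub,
      imgLin_apply, img_eq_zero_iff] at hyp
    -- Modulo ⟨ρ⟩, p z agrees with some y of degree at least m, while p z has degree at most n + L <
    -- m. Truncating the difference at m isolates p z inside ⟨ρ⟩.
    have := trunc_mem_span hhom hyp m
    rw [map_sub, trunc_eq_zero hy, zero_sub, neg_mem_iff, trunc_ofPath_mul, trunc_vertex_mul
      (fun l q => by have := hL l q; have : len ⟨k, i, p⟩ = n := hp; omega)] at this
    rw [pathElt, ← img_mul]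
    exact (img_eq_zero_iff ρ _).2 this
  have hmem : img ρ z ∈ torsionA ρ := by
    refine ⟨⟨n, fun b hb => ?_⟩, hcA⟩
    have hspan := mulE_idealJ_pow_le_span ρ n i (mul_idem_mem_mulE ρ hb i)
    have h0 : (b * idem ρ i) * img ρ (vertex R i * z) = 0 := by
      refine Submodule.span_induction
        (p := fun x _ => x * img ρ (vertex R i * z) = 0) ?_ (zero_mul _)
        (fun x y _ _ hx hy => by rw [add_mul, hx, hy, add_zero])
        (fun a x _ hx => by rw [smul_eq_mul, mul_assoc, hx, mul_zero]) hspan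
      rintro _ ⟨k, p, hp, rfl⟩
      exact hpath k p hp
    rw [hc, mul_assoc, idem, ← img_mul, hc] at h0
    exact h0
  rwa [ht, Ideal.mem_bot] at hmem

/-- Without cycles, each arrow of a path strictly shrinks the finite set of successors of the
current vertex, as the vertex left behind is lost. -/
lemma exists_length_bound (hcyc : HasNoOrientedCycles V) {i : V} (hi : {j : V | Prec i j}.Finite) :
    ∃ L, ∀ (j : V) (p : Quiver.Path i j), p.length ≤ L := by
  refine ⟨{j : V | Prec i j}.ncard, fun j p => ?_⟩
  suffices p.length + {k : V | Prec j k}.ncard ≤ {k : V | Prec i k}.ncard by omega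
  induction p with
  | nil => simp
  | @cons j k p a ih =>
    refine le_trans ?_ ih
    rw [Quiver.Path.length_cons, add_assoc, add_le_add_iff_left, add_comm]
    refine Set.ncard_lt_ncard ⟨fun l ⟨q⟩ => ⟨a.toPath.comp q⟩, fun hle => ?_⟩
      (hi.subset fun l ⟨q⟩ => ⟨p.comp q⟩)
    obtain ⟨q⟩ := hle (show Prec j j from ⟨.nil⟩)
    have := hcyc _ (a.toPath.comp q)
    simp at this

end Truncation

/-! ### The torsion category: local finite presentability and flat objects -/

section TorsionModules

variable {V : Type u} [Quiver.{u} V] {R : Type u} [CommRing R] {ρ : Set (PathAlgebra R V)}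

lemma smul_moduleAeModPow_eq_zero (n : ℕ) (i : V) (x : (moduleAeModPow ρ n i).obj) {b : Alg1 ρ}
    (hb : b ∈ idealJ ρ ^ n) : b • x = 0 := by
  obtain ⟨a, rfl⟩ := Submodule.Quotient.mk_surjective _ x
  refine (Submodule.Quotient.mk_eq_zero _).2 ?_
  refine ⟨b * a, Ideal.mul_mem_right _ _ hb, ?_⟩
  rw [LinearMap.toSpanSingleton_apply, smul_eq_mul, mul_assoc, mul_idem_of_mem_mulE ρ a.2]
  rfl

lemma torsion_moduleAeModPow (n : ℕ) (i : V) : torsion ρ (moduleAeModPow ρ n i) :=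
  fun x => ⟨n, fun _ hb => smul_moduleAeModPow_eq_zero n i x hb⟩

/-- The quotient `A e_i / J^n e_i` as a torsion module. -/
noncomputable def torsionAeModPow (ρ : Set (PathAlgebra R V)) (n : ℕ) (i : V) :
    (torsion ρ).FullSubcategory := ⟨moduleAeModPow ρ n i, torsion_moduleAeModPow n i⟩

attribute [local instance] Cardinal.fact_isRegular_aleph0

lemma isFinitelyPresentable_torsionAeModPow (hfin : IsLocallyFiniteQuiver V) (n : ℕ) (i : V) :
    IsFinitelyPresentable.{u} (torsionAeModPow ρ n i) :=
  have : IsFinitelyPresentable.{u} (torsionAeModPow ρ n i).obj :=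
    isFinitelyPresentable_moduleAeModPow hfin n i
  isFinitelyPresentable_fullSubcategory _ _

/-- The class of `e_i` in `A e_i / J^n e_i`. -/
noncomputable def idemClass (ρ : Set (PathAlgebra R V)) (n : ℕ) (i : V) : (moduleAeModPow ρ n i).obj :=
  Submodule.Quotient.mk (⟨_, idem_mem_mulE_idealA ρ i⟩ : mulE ρ (idealA ρ) i)

lemma idem_smul_idemClass (n : ℕ) (i : V) :
    idem ρ i • idemClass ρ n i = idemClass ρ n i :=
  congrArg Submodule.Quotient.mk (Subtype.ext (idem_mul_idem ρ i))

/-- An element x killed by J^n gives a map from A e_i / J^n e_i that hits e_i x, so these modules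
separate torsion modules. -/
theorem isLocallyFinitelyPresentable_torsion (hfin : IsLocallyFiniteQuiver V) :
    IsLocallyFinitelyPresentable.{u} (torsion ρ).FullSubcategory := by
  refine isLocallyFinitelyPresentable_of_isSeparating
    (.ofObj fun p : ℕ × V => torsionAeModPow ρ p.1 p.2) (fun X Y f g h => ?_) ?_
  · refine ObjectProperty.hom_ext _ (AMod.ext_of_idem fun i x => ?_)
    obtain ⟨n, hn⟩ := X.property x
    have := h _ ⟨(n, i)⟩ (ObjectProperty.homMk (AMod.ofTorsionElt n i x hn))
    exact congrArg (fun k => k.hom.hom.hom (idemClass ρ n i)) this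
  · rintro _ ⟨n, i⟩
    exact isFinitelyPresentable_torsionAeModPow hfin n i

lemma isZero_of_idem_smul_eq_zero {X : AMod ρ} (h : ∀ (i : V) (x : X.obj), idem ρ i • x = 0) :
    IsZero X := by
  refine isZero_of_isZero_obj (unitary ρ).ι ?_
  have : Subsingleton X.obj := subsingleton_of_forall_eq 0 fun x =>
    (Submodule.mem_bot _).1 (mem_of_idem_smul_mem (unitaryPart_eq_top ρ X) fun i =>
      (Submodule.mem_bot _).2 (h i x))
  exact ModuleCat.isZero_of_subsingleton X.obj

open DirectSum in
/-- The direct sum of a family of unitary modules. -/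
noncomputable def AMod.directSum {ι : Type u} (N : ι → AMod ρ) : AMod ρ :=
  AMod.of ρ (⨁ k, (N k).obj) (unitaryPart_directSum _ fun k => unitaryPart_eq_top ρ (N k))

/-- The morphism from a direct sum given by its components. -/
noncomputable def AMod.desc {ι : Type u} {N : ι → AMod ρ} {X : AMod ρ} (f : ∀ k, N k ⟶ X) :
    AMod.directSum N ⟶ X :=
  open Classical in AMod.ofHom (DirectSum.toModule (Alg1 ρ) ι X.obj fun k => (f k).hom.hom)

/-- The projections of a direct sum. -/
noncomputable def AMod.proj {ι : Type u} (N : ι → AMod ρ) (k : ι) :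
    (AMod.directSum N).obj →ₗ[Alg1 ρ] (N k).obj :=
  DirectSum.component (Alg1 ρ) ι (fun k => (N k).obj) k

lemma AMod.proj_ext {ι : Type u} {N : ι → AMod ρ} {x y : (AMod.directSum N).obj}
    (h : ∀ k, AMod.proj N k x = AMod.proj N k y) : x = y := DFinsupp.ext h

lemma AMod.range_le_range_desc {ι : Type u} {N : ι → AMod ρ} {X : AMod ρ} (f : ∀ k, N k ⟶ X)
    (k : ι) : LinearMap.range (f k).hom.hom ≤ LinearMap.range (AMod.desc f).hom.hom := by
  classical
  rintro _ ⟨y, rfl⟩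
  exact ⟨DirectSum.lof (Alg1 ρ) ι (fun k => (N k).obj) k y, DirectSum.toModule_lof _ _ _⟩

lemma torsion_directSum {ι : Type u} {N : ι → AMod ρ} (h : ∀ k, torsion ρ (N k)) :
    torsion ρ (AMod.directSum N) := by
  classical
  intro x
  change x ∈ torsionRadical ρ (DirectSum ι fun k => (N k).obj)
  induction x using DirectSum.induction_on with
  | zero => exact Submodule.zero_mem _
  | of k x =>
    obtain ⟨n, hn⟩ := h k x
    refine ⟨n, fun a ha => ?_⟩
    change a • DirectSum.lof (Alg1 ρ) ι (fun k => (N k).obj) k x = 0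
    rw [← map_smul, hn a ha, map_zero]
  | add x y hx hy => exact Submodule.add_mem _ hx hy

/-- For homogeneous relations, `t(A) = 0` and finitely many successors of each vertex, there are no
nonzero flat torsion modules. -/
theorem hasNoNonzeroFlats_torsion (hfin : IsLocallyFiniteQuiver V) (hcyc : HasNoOrientedCycles V)
    (hhom : IsHomogeneousRel ρ) (ht : torsionA ρ = ⊥) (hsucc : ∀ i : V, {j : V | Prec i j}.Finite) :
    HasNoNonzeroFlats.{u} (torsion ρ).FullSubcategory := by
  intro F hF
  refine isZero_of_isZero_obj (torsion ρ).ι (isZero_of_idem_smul_eq_zero fun i x => ?_)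
  obtain ⟨L, hL⟩ := exists_length_bound hcyc (hsucc i)
  obtain ⟨n, hn⟩ := F.property x
  replace hn : ∀ b ∈ idealJ ρ ^ n, b • idem ρ i • x = 0 := fun b hb => by
    rw [← mul_smul]
    exact hn _ (Ideal.mul_mem_right _ _ hb)
  choose m hm using F.property
  -- The first entry makes the map to F well defined; the second puts J^e e_j beyond every degree
  -- that J^n e_i A can reach.
  let e (k : V × F.obj.obj) : ℕ := max (m k.2) (n + L + 1)
  let N (k : V × F.obj.obj) : AMod ρ := moduleAeModPow ρ (e k) k.1
  let f (k : V × F.obj.obj) : N k ⟶ F.obj := AMod.ofTorsionElt (e k) k.1 k.2 fun a ha =>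
    hm k.2 a (Ideal.pow_le_pow_right (le_max_left _ _) ha)
  let M : (torsion ρ).FullSubcategory :=
    ⟨AMod.directSum N, torsion_directSum fun k => torsion_moduleAeModPow _ _⟩
  let p : M ⟶ F := ObjectProperty.homMk (AMod.desc f)
  have hp : Epi p := by
    refine (torsion ρ).ι.epi_of_epi_map ((AMod.epi_iff _).2 (LinearMap.range_eq_top.1
      (eq_top_iff.2 fun y _ => mem_of_idem_smul_mem (unitaryPart_eq_top ρ F.obj) fun j => ?_)))
    exact AMod.range_le_range_desc f (j, y) ⟨idemClass ρ _ j, rfl⟩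
  obtain ⟨g, hg⟩ := (hF M p hp).2 _ (isFinitelyPresentable_torsionAeModPow hfin n i)
    (ObjectProperty.homMk (AMod.ofTorsionElt n i _ hn))
  have hgx : p.hom.hom.hom (g.hom.hom.hom (idemClass ρ n i)) = idem ρ i • idem ρ i • x :=
    congrArg (fun k => k.hom.hom.hom (idemClass ρ n i)) hg
  suffices g.hom.hom.hom (idemClass ρ n i) = 0 by
    rw [this, map_zero, ← mul_smul, idem_mul_idem] at hgx
    exact hgx.symm
  refine AMod.proj_ext fun k => ?_
  rw [map_zero]
  let φ : (moduleAeModPow ρ n i).obj →ₗ[Alg1 ρ] (N k).obj := AMod.proj N k ∘ₗ g.hom.hom.hom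
  change φ (idemClass ρ n i) = 0
  -- The component is the class of e_i c, and J^n kills it, so J^n e_i c ⊆ J^e e_j;
  -- `eq_zero_of_pow_mul_mem` applies.
  obtain ⟨c, hc⟩ := Submodule.Quotient.mk_surjective _ (φ (idemClass ρ n i))
  have h1 : φ (idemClass ρ n i) = Submodule.Quotient.mk (idem ρ i • c) := by
    rw [← idem_smul_idemClass, map_smul, ← hc]
    rfl
  have h2 : idem ρ i • c = 0 := Subtype.ext <|
    eq_zero_of_pow_mul_mem ρ hhom ht hL (le_max_right (m k.2) _) (j := k.1)
      (mulE_idealA_le ρ _ (idem ρ i • c).2)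
      (by rw [Submodule.coe_smul, smul_eq_mul, ← mul_assoc, idem_mul_idem]) fun b hb => by
      have h0 : b • φ (idemClass ρ n i) = 0 := by
        rw [← map_smul, smul_moduleAeModPow_eq_zero n i _ hb, map_zero]
      rw [h1] at h0
      exact (Submodule.Quotient.mk_eq_zero (Submodule.submoduleOf _ _)
        (x := b • idem ρ i • c)).1 h0
  rw [h1, h2]
  rfl

end TorsionModules

/-! ### The quotient category as the category of torsion-closed modules -/

section Quotient

variable {V : Type u} [Quiver.{u} V] {R : Type u} [CommRing R] {ρ : Set (PathAlgebra R V)}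

/-- In the long exact sequence the obstruction to extending f lies in Ext¹(X₃, Y). -/
lemma exists_extension_of_extOneVanishes {C : Type u} [Category.{v} C] [Abelian C]
    {S : ShortComplex C} (hS : S.ShortExact) {Y : C} (h : ExtOneVanishes S.X₃ Y) (f : S.X₁ ⟶ Y) :
    ∃ g : S.X₂ ⟶ Y, S.f ≫ g = f := by
  let := HasExt.standard C
  have : Subsingleton (Abelian.Ext.{max u v} S.X₃ Y 1) := h
  obtain ⟨x, hx⟩ := Abelian.Ext.contravariant_sequence_exact₁ hS Y (Abelian.Ext.mk₀ f)
    (add_zero 1) (Subsingleton.elim _ _)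
  obtain ⟨g, rfl⟩ := (Abelian.Ext.mk₀_bijective _ _).2 x
  rw [Abelian.Ext.mk₀_comp_mk₀] at hx
  exact ⟨g, (Abelian.Ext.mk₀_bijective _ _).1 hx⟩

variable (ρ) in
lemma mulE_idealJ_le (i : V) : mulE ρ (idealJ ρ) i ≤ mulE ρ (idealA ρ) i :=
  mulE_mono ρ (idealJ_le_idealA ρ) i

variable (ρ) in
/-- The inclusion of `J e_i` in `A e_i`. -/
noncomputable def inclJe (i : V) : moduleJe ρ i ⟶ moduleAe ρ i :=
  AMod.ofHom (Submodule.inclusion (mulE_idealJ_le ρ i))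

variable (ρ) in
/-- The inclusions of the left ideals `J e_i` in `A e_i`. -/
noncomputable abbrev inclusions : MorphismProperty (AMod ρ) := .ofHoms (inclJe ρ)

/-- Multiples of an element of a unitary module, on `A e_i`. -/
lemma AMod.hom_apply {X : AMod ρ} {i : V} (f : moduleAe ρ i ⟶ X) (a : mulE ρ (idealA ρ) i) :
    f.hom.hom a = a.1 • f.hom.hom (⟨_, idem_mem_mulE_idealA ρ i⟩ : mulE ρ (idealA ρ) i) := by
  let φ : mulE ρ (idealA ρ) i →ₗ[Alg1 ρ] X.obj := f.hom.hom
  refine Eq.trans (congrArg φ ?_) (φ.map_smul a.1 ⟨_, idem_mem_mulE_idealA ρ i⟩)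
  exact Subtype.ext (mul_idem_of_mem_mulE ρ a.2).symm

lemma isTorsionClosed_of_exists_extension {X : AMod ρ} (h : torsionRadical ρ X.obj = ⊥)
    (hX : ∀ (i : V) (f : moduleJe ρ i ⟶ X), ∃ g, inclJe ρ i ≫ g = f) : IsTorsionClosed ρ X.obj := by
  refine ⟨h, fun i φ => ?_⟩
  obtain ⟨g, hg⟩ := hX i (AMod.ofHom φ)
  refine ⟨_, fun a => Eq.trans ?_ (AMod.hom_apply g (Submodule.inclusion (mulE_idealJ_le ρ i) a))⟩
  exact (congrArg (fun k => k.hom.hom a) hg).symm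

/-- The objects that are local for the inclusions of `J e_i` in `A e_i` are the torsion-closed
modules. -/
theorem isLocal_inclusions_iff (X : AMod ρ) :
    (inclusions ρ).isLocal X ↔ IsTorsionClosed ρ X.obj := by
  constructor
  · intro h
    refine isTorsionClosed_of_exists_extension ?_ fun i => (h _ ⟨i⟩).2
    rw [torsionRadical_eq, eq_bot_iff]
    -- If J e_i kills x, the map a ↦ a x on A e_i restricts to zero on J e_i, so it is zero by
    -- locality and e_i x = 0.
    refine saturation_le_of_forall (unitaryPart_eq_top ρ X) le_rfl fun i x hx => ?_
    have h0 : inclJe ρ i ≫ AMod.ofElt i x = inclJe ρ i ≫ 0 :=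
      ObjectProperty.hom_ext _ (ModuleCat.hom_ext (LinearMap.ext fun a => hx a.1 a.2))
    exact congrArg (fun k => k.hom.hom (⟨_, idem_mem_mulE_idealA ρ i⟩ : mulE ρ (idealA ρ) i))
      ((h _ ⟨i⟩).1 h0)
  · rintro hX _ _ _ ⟨i⟩
    refine ⟨fun f g hfg => ?_, fun f => ?_⟩
    · have hfg' (a : mulE ρ (idealJ ρ) i) :
          f.hom.hom (Submodule.inclusion (mulE_idealJ_le ρ i) a) =
            g.hom.hom (Submodule.inclusion (mulE_idealJ_le ρ i) a) :=
        congrArg (fun k => k.hom.hom a) hfg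
      have h1 := idem_smul_eq_zero hX.1 (i := i)
        (x := f.hom.hom (⟨_, idem_mem_mulE_idealA ρ i⟩ : mulE ρ (idealA ρ) i) -
          g.hom.hom (⟨_, idem_mem_mulE_idealA ρ i⟩ : mulE ρ (idealA ρ) i)) fun a ha => by
        have := hfg' ⟨a, ha⟩
        rw [AMod.hom_apply f, AMod.hom_apply g] at this
        rw [smul_sub, sub_eq_zero]
        exact this
      rw [smul_sub, sub_eq_zero] at h1
      refine ObjectProperty.hom_ext _ (ModuleCat.hom_ext (LinearMap.ext
        fun (a : mulE ρ (idealA ρ) i) => ?_))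
      refine (AMod.hom_apply f a).trans (Eq.trans ?_ (AMod.hom_apply g a).symm)
      rw [← mul_idem_of_mem_mulE ρ a.2, mul_smul, mul_smul, h1]
    · obtain ⟨m, hm⟩ := hX.2 i f.hom.hom
      exact ⟨AMod.ofElt i m, ObjectProperty.hom_ext _ (ModuleCat.hom_ext (LinearMap.ext fun a =>
        (hm a).symm))⟩

attribute [local instance] Cardinal.fact_isRegular_aleph0

lemma isGrothendieckAbelian_AMod : IsGrothendieckAbelian.{u} (AMod ρ) :=
  have := isLocallyFinitelyPresentable_AMod (ρ := ρ)
  isGrothendieckAbelian_of_isLocallyFinitelyPresentable _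

/-- A torsion-free unitary module embeds in a torsion-closed one. -/
lemma exists_mono_isTorsionClosed (X : AMod ρ) (hX : torsionRadical ρ X.obj = ⊥) :
    ∃ (M : AMod ρ) (f : X ⟶ M), IsTorsionClosed ρ M.obj ∧ Mono f := by
  have := isGrothendieckAbelian_AMod (ρ := ρ)
  let E := Injective.under X
  let j : X ⟶ E := Injective.ι X
  have hj := (AMod.mono_iff j).1 inferInstance
  have hE (N : Submodule (Alg1 ρ) E.obj) (φ : N →ₗ[Alg1 ρ] E.obj) :
      ∃ ψ : E.obj →ₗ[Alg1 ρ] E.obj, ∀ x : N, ψ x = φ x := by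
    let N' : AMod ρ := AMod.of ρ N (unitaryPart_submodule ρ (unitaryPart_eq_top ρ E) N)
    let i : N' ⟶ E := AMod.ofHom N.subtype
    have : Mono i := (AMod.mono_iff i).2 Subtype.val_injective
    let φ' : N' ⟶ E := AMod.ofHom φ
    exact ⟨(Injective.factorThru φ' i).hom.hom, fun x =>
      congrArg (fun k => k.hom.hom x) (Injective.comp_factorThru φ' i)⟩
  have hdisj : Disjoint (LinearMap.range j.hom.hom) (torsionRadical ρ E.obj) := by
    refine Submodule.disjoint_def.2 ?_
    rintro _ ⟨x, rfl⟩ ⟨n, hn⟩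
    have h0 : x = 0 := eq_zero_of_torsionRadical_eq_bot hX n fun a ha => hj (by
      rw [map_smul, hn a ha, map_zero])
    rw [h0, map_zero]
  -- E itself may have torsion; passing to a torsion-free retract that contains X keeps the
  -- extension property.
  obtain ⟨F, π, hXF, hF, hπ, hπF⟩ := exists_retract hE _ _ hdisj
  refine ⟨AMod.of ρ F (unitaryPart_submodule ρ (unitaryPart_eq_top ρ E) F),
    AMod.ofHom (j.hom.hom.codRestrict F fun x => hXF ⟨x, rfl⟩), ?_, ?_⟩
  · refine IsTorsionClosed.of_retract (fun i φ => ?_) F hF π hπ hπF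
    have : Mono (inclJe ρ i) := (AMod.mono_iff _).2 (Submodule.inclusion_injective (mulE_idealJ_le ρ i))
    let φ' : moduleJe ρ i ⟶ E := AMod.ofHom φ
    let g := Injective.factorThru φ' (inclJe ρ i)
    refine ⟨_, fun a => Eq.trans ?_ (AMod.hom_apply g
      (Submodule.inclusion (mulE_idealJ_le ρ i) a))⟩
    exact (congrArg (fun k => k.hom.hom a) (Injective.comp_factorThru φ' (inclJe ρ i))).symm
  · exact (AMod.mono_iff _).2 fun x y hxy => hj (congrArg Subtype.val hxy)

/-- A saturated submodule is the kernel of a morphism to a torsion-closed module. -/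
lemma exists_hom_isTorsionClosed (X : AMod ρ) (N : Submodule (Alg1 ρ) X.obj)
    (hN : saturation N ≤ N) :
    ∃ (M : AMod ρ) (f : X ⟶ M), IsTorsionClosed ρ M.obj ∧ ∀ x, f.hom.hom x = 0 ↔ x ∈ N := by
  let Q : AMod ρ := AMod.of ρ (X.obj ⧸ N) (unitaryPart_quotient ρ (unitaryPart_eq_top ρ X) N)
  obtain ⟨M, f, hM, hf⟩ := exists_mono_isTorsionClosed Q (by
    refine (Submodule.eq_bot_iff _).2 ?_
    rintro x ⟨n, hn⟩
    obtain ⟨x, rfl⟩ := Submodule.Quotient.mk_surjective _ x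
    refine (Submodule.Quotient.mk_eq_zero N).2 (hN ⟨n, fun a ha => ?_⟩)
    exact (Submodule.Quotient.mk_eq_zero N).1 (hn a ha))
  let q : X ⟶ Q := AMod.ofHom N.mkQ
  refine ⟨M, q ≫ f, hM, fun x => ?_⟩
  rw [← Submodule.Quotient.mk_eq_zero N]
  exact map_eq_zero_iff f.hom.hom ((AMod.mono_iff f).1 hf)

/-- The morphisms with torsion kernel and cokernel are those that are inverted by all torsion-closed
modules. -/
theorem isLocal_isLocal_inclusions (hfin : IsLocallyFiniteQuiver V) :
    (inclusions ρ).isLocal.isLocal = torsionIso ρ := by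
  ext X Y f
  change _ ↔ torsion ρ (kernel f) ∧ torsion ρ (cokernel f)
  rw [torsion_kernel_iff, torsion_cokernel_iff]
  constructor
  · intro h
    constructor
    · intro x hx
      -- A map to a torsion-closed module with kernel exactly t(X) factors through f, so the kernel
      -- of f is torsion.
      obtain ⟨M, g, hM, hg⟩ := exists_hom_isTorsionClosed X (torsionRadical ρ X.obj)
        (saturation_saturation hfin (unitaryPart_eq_top ρ X) ⊥)
      obtain ⟨k, rfl⟩ := (h M ((isLocal_inclusions_iff M).2 hM)).2 g
      refine (hg x).1 ?_
      change k.hom.hom (f.hom.hom x) = 0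
      rw [hx, map_zero]
    · obtain ⟨M, g, hM, hg⟩ := exists_hom_isTorsionClosed Y
        (saturation (LinearMap.range f.hom.hom))
        (saturation_saturation hfin (unitaryPart_eq_top ρ Y) _)
      have h0 : f ≫ g = f ≫ 0 := ObjectProperty.hom_ext _ (ModuleCat.hom_ext (LinearMap.ext
        fun x => (hg _).2 (le_saturation _ ⟨x, rfl⟩)))
      have hg0 : g = 0 := (h M ((isLocal_inclusions_iff M).2 hM)).1 h0
      refine eq_top_iff.2 fun y _ => (hg y).1 ?_
      rw [hg0]
      rfl
  · rintro ⟨hker, hcoker⟩ M hM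
    rw [isLocal_inclusions_iff] at hM
    refine ⟨fun g g' h => ?_, fun g => ?_⟩
    · refine ObjectProperty.hom_ext _ (ModuleCat.hom_ext (eq_of_comp_eq hM.1 f.hom.hom hcoker
        fun x => congrArg (fun k => k.hom.hom x) h))
    · obtain ⟨h, hh⟩ := hM.exists_extension hfin (unitaryPart_eq_top ρ Y) (unitaryPart_eq_top ρ M)
        f.hom.hom g.hom.hom (fun x hx => by
          obtain ⟨n, hn⟩ := hker x hx
          exact eq_zero_of_torsionRadical_eq_bot hM.1 n fun a ha => by
            rw [← map_smul, hn a ha, map_zero]) hcoker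
      exact ⟨AMod.ofHom h, ObjectProperty.hom_ext _ (ModuleCat.hom_ext (LinearMap.ext hh))⟩

lemma isFinitelyPresentable_of_inclusions (hρ : IsAdmissible ρ) (hρfin : IsLocallyFiniteRel ρ)
    (hfin : IsLocallyFiniteQuiver V) ⦃X Y : AMod ρ⦄ (f : X ⟶ Y) (hf : inclusions ρ f) :
    IsCardinalPresentable X Cardinal.aleph0.{u} ∧ IsCardinalPresentable Y Cardinal.aleph0.{u} := by
  obtain ⟨i⟩ := hf
  exact ⟨isFinitelyPresentable_moduleJe hρ hρfin hfin i, isFinitelyPresentable_moduleAe i⟩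

/-- The objects local for a small family of maps between finitely presentable objects form a
reflective subcategory; finite presentation of J e_i enters here. -/
lemma isRightAdjoint_ι_inclusions (hρ : IsAdmissible ρ) (hρfin : IsLocallyFiniteRel ρ)
    (hfin : IsLocallyFiniteQuiver V) : (inclusions ρ).isLocal.ι.IsRightAdjoint :=
  have := isGrothendieckAbelian_AMod (ρ := ρ)
  MorphismProperty.isRightAdjoint_ι_isLocal _ Cardinal.aleph0.{u}
    (isFinitelyPresentable_of_inclusions hρ hρfin hfin)

lemma isLocallyFinitelyPresentable_inclusions (hρ : IsAdmissible ρ) (hρfin : IsLocallyFiniteRel ρ)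
    (hfin : IsLocallyFiniteQuiver V) :
    IsLocallyFinitelyPresentable.{u} (inclusions ρ).isLocal.FullSubcategory :=
  have := isLocallyFinitelyPresentable_AMod (ρ := ρ)
  MorphismProperty.isLocallyPresentable_isLocal _ Cardinal.aleph0.{u}
    (isFinitelyPresentable_of_inclusions hρ hρfin hfin)

/-- The quotient category is equivalent to the category of torsion-closed modules. -/
theorem nonempty_equivalence (hρ : IsAdmissible ρ) (hρfin : IsLocallyFiniteRel ρ)
    (hfin : IsLocallyFiniteQuiver V) :
    Nonempty ((inclusions ρ).isLocal.FullSubcategory ≌ AModModTorsion ρ) := by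
  have := isRightAdjoint_ι_inclusions hρ hρfin hfin
  let adj := Adjunction.ofIsRightAdjoint (inclusions ρ).isLocal.ι
  -- The reflection is a localization at the maps inverted by all torsion-closed modules. These are
  -- the maps with torsion kernel and cokernel, so uniqueness of localizations gives the
  -- equivalence.
  have hL := ObjectProperty.isLocalization_isLocal adj
  have hrange : (· ∈ Set.range (inclusions ρ).isLocal.ι.obj) = (inclusions ρ).isLocal := by
    ext X
    exact ⟨fun ⟨Y, hY⟩ => hY ▸ Y.property, fun h => ⟨⟨X, h⟩, rfl⟩⟩
  rw [hrange, isLocal_isLocal_inclusions hfin] at hL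
  exact ⟨Localization.uniq (Functor.leftAdjoint (inclusions ρ).isLocal.ι) (torsionIso ρ).Q (torsionIso ρ)⟩

/-- The quotient category is abelian. -/
theorem nonempty_abelian_AModModTorsion (hfin : IsLocallyFiniteQuiver V) :
    Nonempty (Abelian (AModModTorsion ρ)) := by
  have := isSerreClass_torsion ρ hfin
  -- `torsionIso ρ` is by definition the class of isomorphisms modulo the Serre class `torsion ρ`.
  exact ⟨(ObjectProperty.SerreClassLocalization.abelian ((torsion ρ).isoModSerre).Q (torsion ρ) :
    Abelian (torsion ρ).isoModSerre.Localization)⟩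

end Quotient

/-! ### Flat objects of the quotient category -/

section QuotientFlats

variable {V : Type u} [Quiver.{u} V] {R : Type u} [CommRing R] {ρ : Set (PathAlgebra R V)}

variable (ρ) in
lemma torsionRadical_moduleAeModTorsion (hfin : IsLocallyFiniteQuiver V) (j : V) :
    torsionRadical ρ (moduleAeModTorsion ρ j).obj = ⊥ := by
  refine (Submodule.eq_bot_iff _).2 ?_
  rintro x ⟨n, hn⟩
  obtain ⟨a, rfl⟩ := Submodule.Quotient.mk_surjective _ x
  refine (Submodule.Quotient.mk_eq_zero _).2 ?_
  -- Here a is torsion modulo torsion elements, hence torsion, since saturating twice gains nothing.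
  have ha : a ∈ saturation (ρ := ρ) (saturation (⊥ : Submodule (Alg1 ρ) (mulE ρ (idealA ρ) j))) := by
    refine ⟨n, fun b hb => ?_⟩
    obtain ⟨c, ⟨⟨m, hm⟩, hcA⟩, hc⟩ := (Submodule.Quotient.mk_eq_zero (Submodule.submoduleOf _ _)
      (x := b • a)).1 (hn b hb)
    refine ⟨m, fun d hd => (Submodule.mem_bot _).2 (Subtype.ext ?_)⟩
    have hc' : c * idem ρ j = (b • a : mulE ρ (idealA ρ) j).1 := hc
    have hdc : d * c = 0 := hm d hd
    rw [Submodule.coe_smul, ← hc', smul_eq_mul, ← mul_assoc, hdc, zero_mul]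
    rfl
  obtain ⟨m, hm⟩ := saturation_saturation hfin
    (unitaryPart_of_le_idealA ρ (mulE_idealA_le ρ j)) ⊥ ha
  refine ⟨a.1, ⟨⟨m, fun b hb => ?_⟩, mulE_idealA_le ρ j a.2⟩, mul_idem_of_mem_mulE ρ a.2⟩
  exact congrArg Subtype.val ((Submodule.mem_bot _).1 (hm b hb))

/-- The vanishing of `Ext¹(B e_i, -)` on `A e_j / t(A) e_j` makes this module torsion-closed. -/
lemma isTorsionClosed_moduleAeModTorsion (hfin : IsLocallyFiniteQuiver V) (j : V)
    (h : ∀ i : V, ExtOneVanishes (moduleBe ρ i) (moduleAeModTorsion ρ j)) :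
    IsTorsionClosed ρ (moduleAeModTorsion ρ j).obj := by
  refine isTorsionClosed_of_exists_extension (torsionRadical_moduleAeModTorsion ρ hfin j)
    fun i f => ?_
  let K := (mulE ρ (idealJ ρ) i).submoduleOf (mulE ρ (idealA ρ) i)
  let q : moduleAe ρ i ⟶ moduleBe ρ i := AMod.ofHom K.mkQ
  have hS : (ShortComplex.mk (inclJe ρ i) q (ObjectProperty.hom_ext _ (ModuleCat.hom_ext
      (LinearMap.ext fun a => (Submodule.Quotient.mk_eq_zero K).2 a.2)))).ShortExact := by
    refine AMod.shortExact_of _ _ _ (Submodule.inclusion_injective (mulE_idealJ_le ρ i))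
      K.mkQ_surjective fun x hx => ?_
    exact ⟨⟨x.1, (Submodule.Quotient.mk_eq_zero K).1 hx⟩, rfl⟩
  exact exists_extension_of_extOneVanishes hS (h i) f

/-- The morphism `A e_j / t(A) e_j → X` given by an element of a torsion-free module. -/
noncomputable def AMod.ofTorsionFreeElt {X : AMod ρ} (hX : torsionRadical ρ X.obj = ⊥) (j : V)
    (x : X.obj) : moduleAeModTorsion ρ j ⟶ X :=
  AMod.ofHom (Submodule.liftQ _
    ((LinearMap.toSpanSingleton (Alg1 ρ) X.obj x).domRestrict (mulE ρ (idealA ρ) j)) (by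
      rintro a ⟨b, ⟨⟨n, hn⟩, -⟩, hb⟩
      refine eq_zero_of_torsionRadical_eq_bot hX n fun c hc => ?_
      have hb' : b * idem ρ j = a.1 := hb
      have hcb : c * b = 0 := hn c hc
      change c • a.1 • x = 0
      rw [← hb', ← mul_smul, ← mul_assoc, hcb, zero_mul, zero_smul]))

lemma idem_smul_mem_range_ofTorsionFreeElt {X : AMod ρ} (hX : torsionRadical ρ X.obj = ⊥) (j : V)
    (x : X.obj) : idem ρ j • x ∈ LinearMap.range (AMod.ofTorsionFreeElt hX j x).hom.hom :=
  ⟨Submodule.Quotient.mk (⟨_, idem_mem_mulE_idealA ρ j⟩ : mulE ρ (idealA ρ) j), rfl⟩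

/-- The space e_i A e_k is spanned by the paths from i to k. -/
lemma idem_mul_eq_zero {i k : V} (h : ¬ Prec i k) {a : Alg1 ρ} (ha : a ∈ mulE ρ (idealA ρ) k) :
    idem ρ i * a = 0 := by
  obtain ⟨y, rfl⟩ := exists_img_eq ρ (mulE_idealA_le ρ k ha)
  rw [← mul_idem_of_mem_mulE ρ ha, ← mul_assoc]
  refine PathAlgebra.induction (P := fun y => idem ρ i * img ρ y * idem ρ k = 0) y
    (by rw [img_zero, mul_zero, zero_mul])
    (fun x y hx hy => by rw [img_add, mul_add, add_mul, hx, hy, add_zero]) (fun r p => ?_)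
  rw [img_smul, mul_smul_comm, smul_mul_assoc]
  obtain ⟨l, l', p⟩ := p
  change r • (idem ρ i * pathElt ρ p * idem ρ k) = 0
  by_cases hl : i = l
  · subst hl
    rw [mul_assoc, pathElt_mul_idem_of_ne ρ (show l' ≠ k from fun hk => h (hk ▸ ⟨p⟩)), mul_zero, smul_zero]
  · rw [idem_eq_pathElt ρ i, pathElt_mul_pathElt_of_ne ρ hl, zero_mul, smul_zero]

lemma idem_smul_moduleAeModTorsion_eq_zero {i k : V} (h : ¬ Prec i k)
    (x : (moduleAeModTorsion ρ k).obj) : idem ρ i • x = 0 := by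
  obtain ⟨a, rfl⟩ := Submodule.Quotient.mk_surjective _ x
  have : idem ρ i • a = 0 := Subtype.ext (idem_mul_eq_zero h a.2)
  exact congrArg Submodule.Quotient.mk this

lemma Prec.trans {i j k : V} : Prec i j → Prec j k → Prec i k := fun ⟨p⟩ ⟨q⟩ => ⟨p.comp q⟩

lemma Prec.antisymm (hcyc : HasNoOrientedCycles V) {i j : V} : Prec i j → Prec j i → i = j := by
  rintro ⟨p⟩ ⟨q⟩
  have := hcyc i (p.comp q)
  rw [Quiver.Path.length_comp] at this
  exact Quiver.Path.eq_of_length_zero p (by omega)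

/-- In a narrow quiver without oriented cycles the intervals are finite. -/
lemma finite_interval (hcyc : HasNoOrientedCycles V) (hnar : IsNarrow V) (i j : V) :
    {k : V | Prec i k ∧ Prec k j}.Finite := by
  by_cases hij : Prec i j
  -- With a proper predecessor i' of i, no k ⪰ i can precede i', so narrowness for i' ⪯ j bounds the
  -- interval. Otherwise i is its own only predecessor, and narrowness for i ⪯ j bounds the interval
  -- apart from i.
  · by_cases h : ∃ i', Prec i' i ∧ i' ≠ i
    · obtain ⟨i', hi', hne⟩ := h
      refine (hnar j i' (hi'.trans hij)).subset fun k hk => ⟨hk.2, fun hki => ?_⟩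
      exact hne (hi'.antisymm hcyc (hk.1.trans hki))
    · push Not at h
      refine ((hnar j i hij).union (Set.finite_singleton i)).subset fun k hk => ?_
      by_cases hki : Prec k i
      · exact Or.inr (h k hki)
      · exact Or.inl ⟨hk.2, hki⟩
  · refine Set.finite_empty.subset fun k hk => hij (hk.1.trans hk.2)

/-- Each arrow strictly shrinks the interval from the current vertex to j, and all these intervals
lie in the finite one from i to j. -/
lemma exists_length_bound_of_interval (hcyc : HasNoOrientedCycles V) {i j : V}
    (hij : {k : V | Prec i k ∧ Prec k j}.Finite) :
    ∃ L, ∀ (k : V) (p : Quiver.Path k j), Prec i k → p.length ≤ L := by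
  refine ⟨{k : V | Prec i k ∧ Prec k j}.ncard, fun k p hk => ?_⟩
  suffices ∀ (l : V) (q : Quiver.Path k l), Prec l j →
      q.length + {m : V | Prec l m ∧ Prec m j}.ncard ≤ {m : V | Prec k m ∧ Prec m j}.ncard by
    have h1 := this j p ⟨.nil⟩
    have h2 : {m : V | Prec k m ∧ Prec m j}.ncard ≤ {m : V | Prec i m ∧ Prec m j}.ncard :=
      Set.ncard_le_ncard (fun m hm => ⟨hk.trans hm.1, hm.2⟩) hij
    omega
  intro l q
  induction q with
  | nil => simp
  | @cons l l' q a ih =>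
    intro hl'
    have hl : Prec l l' := ⟨a.toPath⟩
    refine le_trans ?_ (ih (hl.trans hl'))
    rw [Quiver.Path.length_cons, add_assoc, add_le_add_iff_left, add_comm]
    refine Set.ncard_lt_ncard ⟨fun m hm => ⟨hl.trans hm.1, hm.2⟩, fun hle => ?_⟩
      (hij.subset fun m hm => ⟨hk.trans (Prec.trans ⟨q⟩ hm.1), hm.2⟩)
    obtain ⟨⟨r⟩, -⟩ := hle (show Prec l l ∧ Prec l j from ⟨⟨.nil⟩, hl.trans hl'⟩)
    have := hcyc _ (a.toPath.comp r)
    simp at this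

attribute [local instance] Cardinal.fact_isRegular_aleph0

/-- There are no nonzero flat torsion-closed modules. -/
theorem hasNoNonzeroFlats_inclusions (hρ : IsAdmissible ρ) (hρfin : IsLocallyFiniteRel ρ)
    (hfin : IsLocallyFiniteQuiver V) (hcyc : HasNoOrientedCycles V) (hnar : IsNarrow V)
    (hext : ∀ i j : V, ExtOneVanishes (moduleBe ρ i) (moduleAeModTorsion ρ j)) :
    HasNoNonzeroFlats.{u} (inclusions ρ).isLocal.FullSubcategory := by
  intro F hF
  refine isZero_of_isZero_obj (inclusions ρ).isLocal.ι (isZero_of_idem_smul_eq_zero fun i x => ?_)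
  have hFc : IsTorsionClosed ρ F.obj.obj := (isLocal_inclusions_iff _).1 F.property
  -- Only vertices k with i ⋠ k are used, so that e_i annihilates the whole direct sum.
  let N (k : {k : V // ¬ Prec i k} × F.obj.obj) : AMod ρ := moduleAeModTorsion ρ k.1.1
  let f (k : {k : V // ¬ Prec i k} × F.obj.obj) : N k ⟶ F.obj :=
    AMod.ofTorsionFreeElt hFc.1 k.1.1 k.2
  have hM : IsTorsionClosed ρ (AMod.directSum N).obj :=
    IsTorsionClosed.directSum hfin _ fun k =>
      isTorsionClosed_moduleAeModTorsion hfin k.1.1 fun i => hext i k.1.1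
  let M : (inclusions ρ).isLocal.FullSubcategory :=
    ⟨AMod.directSum N, (isLocal_inclusions_iff _).2 hM⟩
  let p : M ⟶ F := ObjectProperty.homMk (AMod.desc f)
  have hsat : saturation (LinearMap.range p.hom.hom.hom) = ⊤ := by
    refine eq_top_iff.2 fun y _ => mem_of_idem_smul_mem (unitaryPart_eq_top ρ F.obj) fun j => ?_
    obtain ⟨L, hL⟩ := exists_length_bound_of_interval hcyc (finite_interval hcyc hnar i j)
    -- A path of length L + 1 into j starts at some k with i ⋠ k, so it moves y into the image of a
    -- summand at k.
    refine ⟨L + 1, fun b hb => ?_⟩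
    rw [← mul_smul]
    refine Submodule.span_induction (p := fun c _ => c • y ∈ LinearMap.range p.hom.hom.hom) ?_ ?_ ?_
      ?_ (mulE_idealJ_pow_le_span ρ _ j (mul_idem_mem_mulE ρ hb j))
    · rintro _ ⟨k, q, hq, rfl⟩
      have hk : ¬ Prec i k := fun hk => by
        have := hL k q hk
        omega
      rw [← idem_mul_pathElt, mul_smul]
      exact AMod.range_le_range_desc f (⟨k, hk⟩, pathElt ρ q • y)
        (idem_smul_mem_range_ofTorsionFreeElt hFc.1 k _)
    · rw [zero_smul]
      exact Submodule.zero_mem _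
    · intro c d _ _ hc hd
      rw [add_smul]
      exact Submodule.add_mem _ hc hd
    · intro a c _ hc
      rw [smul_eq_mul, mul_smul]
      exact Submodule.smul_mem _ _ hc
  -- Between torsion-closed modules, torsion cokernel suffices for an epimorphism; p need not be
  -- surjective.
  have hp : Epi p := ⟨fun {Z} g g' h => by
    refine ObjectProperty.hom_ext _ (ObjectProperty.hom_ext _ (ModuleCat.hom_ext ?_))
    exact eq_of_comp_eq ((isLocal_inclusions_iff _).1 Z.property).1 p.hom.hom.hom hsat
      fun x => congrArg (fun k => k.hom.hom.hom x) h⟩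
  have := isGrothendieckAbelian_AMod (ρ := ρ)
  have hW := isFinitelyPresentable_of_inclusions hρ hρfin hfin
  have := isRightAdjoint_ι_inclusions hρ hρfin hfin
  have := (inclusions ρ).isCardinalAccessible_ι_isLocal Cardinal.aleph0.{u} hW
  let adj := Adjunction.ofIsRightAdjoint (inclusions ρ).isLocal.ι
  have : IsCardinalPresentable (moduleAe ρ i) Cardinal.aleph0.{u} :=
    isFinitelyPresentable_moduleAe i
  -- The test object is the reflection of A e_i, finitely presentable because the inclusion of the
  -- torsion-closed modules preserves filtered colimits. By adjunction the lift becomes an element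
  -- of M fixed by e_i, hence zero.
  obtain ⟨g, hg⟩ := (hF M p hp).2 _
    (adj.isCardinalPresentable_leftAdjoint_obj Cardinal.aleph0.{u} (moduleAe ρ i))
    ((adj.homEquiv _ _).symm (AMod.ofElt (X := F.obj) i x))
  have hg' : adj.homEquiv _ _ g ≫ p.hom = AMod.ofElt (X := F.obj) i x := by
    have := adj.homEquiv_naturality_right g p
    rw [hg, Equiv.apply_symm_apply] at this
    exact this.symm
  let φ : mulE ρ (idealA ρ) i →ₗ[Alg1 ρ] (AMod.directSum N).obj := (adj.homEquiv _ _ g).hom.hom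
  let e : mulE ρ (idealA ρ) i := ⟨_, idem_mem_mulE_idealA ρ i⟩
  have he : idem ρ i • e = e := Subtype.ext (idem_mul_idem ρ i)
  have h0 : φ e = 0 := by
    rw [← he, map_smul]
    refine AMod.proj_ext fun k => ?_
    rw [map_smul, map_zero]
    exact idem_smul_moduleAeModTorsion_eq_zero k.1.2 _
  have h1 : p.hom.hom.hom (φ e) = idem ρ i • x := congrArg (fun k => k.hom.hom e) hg'
  rw [← h1, h0, map_zero]

end QuotientFlats

end QuiverRel

theorem mainTheorem4 (R : Type u) [CommRing R] (V : Type u) [Quiver.{u} V]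
    (ρ : Set (PathAlgebra R V)) (hρ : IsAdmissible ρ) (hρfin : IsLocallyFiniteRel ρ)
    (hconn : IsConnectedQuiver V) (hfin : IsLocallyFiniteQuiver V) (hcyc : HasNoOrientedCycles V) :
    (IsHomogeneousRel ρ → torsionA ρ = ⊥ → (∀ i : V, {j : V | Prec i j}.Finite) →
      IsGrothendieckCategory.{u} (torsion ρ).FullSubcategory ∧
      IsLocallyFinitelyPresentable.{u} (torsion ρ).FullSubcategory ∧
      HasNoNonzeroFlats.{u} (torsion ρ).FullSubcategory) ∧
    (IsDownwardDirected V → IsNarrow V →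
      (∀ i j : V, ExtOneVanishes (moduleBe ρ i) (moduleAeModTorsion ρ j)) →
      IsGrothendieckCategory.{u} (AModModTorsion ρ) ∧
      IsLocallyFinitelyPresentable.{u} (AModModTorsion ρ) ∧
      HasNoNonzeroFlats.{u} (AModModTorsion ρ)) := by
  refine ⟨fun hhom ht hsucc => ?_, fun _ hnar hext => ?_⟩
  · have hlfp := isLocallyFinitelyPresentable_torsion (ρ := ρ) hfin
    exact ⟨⟨inferInstance, isGrothendieckAbelian_of_isLocallyFinitelyPresentable _⟩, hlfp,
      hasNoNonzeroFlats_torsion hfin hcyc hhom ht hsucc⟩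
  · obtain ⟨e⟩ := nonempty_equivalence hρ hρfin hfin
    have hlfp := isLocallyFinitelyPresentable_inclusions hρ hρfin hfin
    have : Fact Cardinal.aleph0.{u}.IsRegular := Cardinal.fact_isRegular_aleph0
    have hlfp' : IsLocallyFinitelyPresentable.{u} (AModModTorsion ρ) :=
      e.isCardinalLocallyPresentable Cardinal.aleph0.{u}
    obtain ⟨hab⟩ := nonempty_abelian_AModModTorsion (ρ := ρ) hfin
    exact ⟨⟨hab, isGrothendieckAbelian_of_isLocallyFinitelyPresentable _⟩, hlfp',
      HasNoNonzeroFlats.of_equivalence e (hasNoNonzeroFlats_inclusions hρ hρfin hfin hcyc hnar hext)⟩
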